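/- Let $N\ge 1$ be an integer, $s\in(0,1)$, $q\in(1,2)$, and let $\Omega\subset\mathbb R^N$ be a non-empty open set. For $u:\mathbb R^N\to\mathbb R$ put $$E_s(u)=\int_{\mathbb R^N}\int_{\mathbb R^N}\frac{(u(x)-u(y))^2}{|x-y|^{N+2s}}\,dx\,dy ,\qquad \lambda_1=\lambda_1(\Omega,s,q)=\inf\Big\{E_s(\varphi):\varphi\in C^\infty_0(\Omega),\ \int_\Omega|\varphi|^q\,dx=1\Big\},$$ and assume $\lambda_1>0$. Let $\mathcal D^{s,2}_0(\Omega)$ be the completion of $C^\infty_0(\Omega)$ with respect to the norm $E_s^{1/2}$; since $\lambda_1>0$, it is a space of functions on $\mathbb R^N$ (modulo equality a.e.), namely of those $u$ for which there are $\varphi_n\in C_0^\infty(\Omega)$ with $E_s(\varphi_n-u)\to0$ and $\varphi_n\to u$ a.e. A number $\lambda>0$ is a $q$-semilinear $s$-eigenvalue of $\Omega$, with eigenfunction $u$, if $u\in\mathcal D^{s,2}_0(\Omega)\cap L^q(\Omega)$, $u\neq0$, and $$\int_{\mathbb R^N}\int_{\mathbb R^N}\frac{(u(x)-u(y))(\varphi(x)-\varphi(y))}{|x-y|^{N+2s}}\,dx\,dy=\lambda\,\|u\|_{L^q(\Omega)}^{2-q}\int_\Omega|u|^{q-2}u\,\varphi\,dx\qquad\text{for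 all }\varphi\in\mathcal D^{s,2}_0(\Omega).$$ Then: 1. $\lambda_1<\infty$, and $\lambda_1$ is the minimum of $E_s$ over $\{u\in\mathcal D^{s,2}_0(\Omega):\int_\Omega|u|^q\,dx=1\}$; in particular it is attained there. 2. $\lambda_1$ is the least $q$-semilinear $s$-eigenvalue of $\Omega$, and its eigenfunctions are precisely the non-zero multiples of the minimisers in (1). 3. The minimiser, and likewise the eigenfunction of $\lambda_1$, is unique up to a non-zero multiplicative constant. 4. Every eigenfunction of $\lambda_1$ has constant sign: it is either $>0$ a.e. in $\Omega$ or $<0$ a.e. in $\Omega$. 5. $\lambda_1$ is the only $q$-semilinear $s$-eigenvalue that has an eigenfunction of constant sign: if $u$ is an eigenfunction with eigenvalue $\lambda$ and $u\ge0$ a.e. in $\Omega$ or $u\le 0$ a.e. in $\Omega$, then $\lambda=\lambda_1$. -/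

import Mathlib

open MeasureTheory Filter Topology
open scoped ENNReal ContDiff

namespace FracEig

/-- `φ ∈ C^∞_0(Ω)`: smooth with compact support contained in `Ω`. -/
def IsTestFunction {N : ℕ} (Ω : Set (EuclideanSpace ℝ (Fin N)))
    (φ : EuclideanSpace ℝ (Fin N) → ℝ) : Prop :=
  ContDiff ℝ ∞ φ ∧ HasCompactSupport φ ∧ tsupport φ ⊆ Ω

/-- The double integral of `(u(x) - u(y))² / |x - y|^(N + 2s)` over `ℝ^N × ℝ^N`,
as an element of `[0, ∞]`. -/
noncomputable def energy {N : ℕ} (s : ℝ) (u : EuclideanSpace ℝ (Fin N) → ℝ) : ℝ≥0∞ :=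
  ∫⁻ p : EuclideanSpace ℝ (Fin N) × EuclideanSpace ℝ (Fin N),
    ENNReal.ofReal ((u p.1 - u p.2) ^ 2 / ‖p.1 - p.2‖ ^ ((N : ℝ) + 2 * s))

/-- The double integral of `(u(x) - u(y)) (φ(x) - φ(y)) / |x - y|^(N + 2s)` over `ℝ^N × ℝ^N`.
The integrand is integrable as soon as `u` and `φ` have finite energy. -/
noncomputable def energyForm {N : ℕ} (s : ℝ) (u φ : EuclideanSpace ℝ (Fin N) → ℝ) : ℝ :=
  ∫ p : EuclideanSpace ℝ (Fin N) × EuclideanSpace ℝ (Fin N),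
    (u p.1 - u p.2) * (φ p.1 - φ p.2) / ‖p.1 - p.2‖ ^ ((N : ℝ) + 2 * s)

/-- The first eigenvalue
`λ₁(Ω, s, q) = inf { energy s φ : φ ∈ C^∞_0(Ω), ∫_Ω |φ|^q = 1 }`, as an element of `[0, ∞]`. -/
noncomputable def lambdaOne {N : ℕ} (Ω : Set (EuclideanSpace ℝ (Fin N))) (s q : ℝ) : ℝ≥0∞ :=
  sInf {e | ∃ φ : EuclideanSpace ℝ (Fin N) → ℝ,
    IsTestFunction Ω φ ∧ ∫ x in Ω, |φ x| ^ q = 1 ∧ e = energy s φ}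

/-- The completion `D^{s,2}_0(Ω)` of `C^∞_0(Ω)` in the norm `energy ^ (1/2)`, realised as a space
of functions on `ℝ^N` (up to equality almost everywhere): those `u` that are the limit, in that
norm and almost everywhere, of a sequence of test functions.

If `λ₁(Ω, s, q) > 0` for some `q ≥ 1`, then a sequence of test functions that is Cauchy in this
norm is Cauchy in `L^q(Ω)`, so that every element of the abstract completion is represented by
exactly one such function modulo equality a.e. -/
def D0 {N : ℕ} (Ω : Set (EuclideanSpace ℝ (Fin N))) (s : ℝ) :
    Set (EuclideanSpace ℝ (Fin N) → ℝ) :=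
  {u | ∃ φ : ℕ → EuclideanSpace ℝ (Fin N) → ℝ,
    (∀ n, IsTestFunction Ω (φ n)) ∧
    Tendsto (fun n => energy s (φ n - u)) atTop (𝓝 0) ∧
    ∀ᵐ x, Tendsto (fun n => φ n x) atTop (𝓝 (u x))}

/-- The constraint set `{u ∈ D^{s,2}_0(Ω) : ∫_Ω |u|^q = 1}`. (As the Bochner integral of a
non-integrable function is `0`, the condition entails that `|u|^q` is integrable on `Ω`.) -/
def constraintSet {N : ℕ} (Ω : Set (EuclideanSpace ℝ (Fin N))) (s q : ℝ) :
    Set (EuclideanSpace ℝ (Fin N) → ℝ) :=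
  {u | u ∈ D0 Ω s ∧ ∫ x in Ω, |u x| ^ q = 1}

/-- `u` achieves the minimum that defines `λ₁(Ω, s, q)`. -/
def IsMinimiser {N : ℕ} (Ω : Set (EuclideanSpace ℝ (Fin N))) (s q : ℝ)
    (u : EuclideanSpace ℝ (Fin N) → ℝ) : Prop :=
  u ∈ constraintSet Ω s q ∧ energy s u = lambdaOne Ω s q

/-- `u` is a `q`-semilinear `s`-eigenfunction with eigenvalue `lam > 0`: a non-trivial weak
solution in `D^{s,2}_0(Ω)` of `(-Δ)^s u = lam ‖u‖_{L^q(Ω)}^(2-q) |u|^(q-2) u`. -/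
structure IsEigenfunction {N : ℕ} (Ω : Set (EuclideanSpace ℝ (Fin N))) (s q : ℝ) (lam : ℝ)
    (u : EuclideanSpace ℝ (Fin N) → ℝ) : Prop where
  pos : 0 < lam
  mem : u ∈ D0 Ω s
  integrableOn : IntegrableOn (fun x => |u x| ^ q) Ω
  nontrivial : ¬ u =ᵐ[volume] 0
  weak : ∀ φ ∈ D0 Ω s,
    energyForm s u φ =
      lam * ((∫ x in Ω, |u x| ^ q) ^ (1 / q)) ^ (2 - q) *
        ∫ x in Ω, |u x| ^ (q - 2) * u x * φ x

/-- The `q`-semilinear `s`-spectrum of `Ω`. -/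
def spectrum {N : ℕ} (Ω : Set (EuclideanSpace ℝ (Fin N))) (s q : ℝ) : Set ℝ :=
  {lam | ∃ u, IsEigenfunction Ω s q lam u}

end FracEig

/-!
The energy of `u` is the squared `L²` norm of its difference quotient, so membership in
`D^{s,2}_0(Ω)` can be tested along sequences of bounded energy that converge a.e.: by the
parallelogram law, convex combinations of nearly least energy taken from their tails are Cauchy.

Existence and uniqueness both rest on the submodularity
`E(max u v) + E(min u v) ≤ E(u) + E(v)`. Together with `λ₁ ‖w‖_q² ≤ E(w)` for `w = max u v` and
`w = min u v`, and the strict convexity of `t ↦ t^{2/q}`, it forces `∫ ||u|^q - |v|^q|` to be small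
for non-negative `u`, `v` far out in a minimising sequence; for two minimisers it becomes an
equality, which holds only if one of them lies below the other. Comparing a minimiser `u` with `-u`
gives its constant sign, and comparing two non-negative minimisers gives uniqueness.

Testing the equation of a non-negative eigenfunction with `φ² / (u + ε)` and using the discrete
Picone identity gives, as `ε → 0`, both the strict positivity of `u` and
`λ ∫ u^{q-2} φ² ≤ E(φ)`, which by Young's inequality implies `λ ≤ λ₁`.
-/

namespace FracEig

section MeasureTheory

variable {α : Type*} [MeasurableSpace α] {μ : Measure α}

lemma ae_prod_of_ae {β : Type*} [MeasurableSpace β] {ν : Measure β} {P : α → Prop}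
    {R : β → Prop} (hP : ∀ᵐ x ∂μ, P x) (hR : ∀ᵐ y ∂ν, R y) :
    ∀ᵐ p ∂μ.prod ν, P p.1 ∧ R p.2 :=
  (Measure.quasiMeasurePreserving_fst.ae hP).and (Measure.quasiMeasurePreserving_snd.ae hR)

lemma ae_not_or_ae_not_of_ae_prod {β : Type*} [MeasurableSpace β] {ν : Measure β} [SFinite ν]
    {P : α → Prop} {R : β → Prop} (h : ∀ᵐ p ∂μ.prod ν, ¬ (P p.1 ∧ R p.2)) :
    (∀ᵐ x ∂μ, ¬ P x) ∨ ∀ᵐ y ∂ν, ¬ R y := by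
  by_contra! hc
  obtain ⟨hP, hR⟩ := hc
  obtain ⟨x, hx, hxR⟩ :=
    ((not_eventually.1 hP).and_eventually (Measure.ae_ae_of_ae_prod h)).exists
  exact hR (hxR.mono fun y hy hRy => hy ⟨not_not.1 hx, hRy⟩)

lemma ae_not_tendsto_top_of_lintegral_le {f : ℕ → α → ℝ≥0∞} (hf : ∀ n, AEMeasurable (f n) μ)
    {C : ℝ≥0∞} (hC : C ≠ ⊤) (h : ∀ n, ∫⁻ x, f n x ∂μ ≤ C) :
    ∀ᵐ x ∂μ, ¬ Tendsto (fun n => f n x) atTop (𝓝 ⊤) := by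
  have hliminf : ∫⁻ x, liminf (fun n => (hf n).mk (f n) x) atTop ∂μ ≠ ⊤ := by
    refine ne_top_of_le_ne_top hC ((lintegral_liminf_le fun n => (hf n).measurable_mk).trans
      (liminf_le_of_frequently_le' (Frequently.of_forall fun n => ?_)))
    exact (lintegral_congr_ae (hf n).ae_eq_mk).symm.trans_le (h n)
  filter_upwards [ae_lt_top (Measurable.liminf fun n => (hf n).measurable_mk) hliminf,
    ae_all_iff.2 fun n => (hf n).ae_eq_mk] with x hx hmk htop
  simp only [← hmk] at hx
  exact hx.ne htop.liminf_eq

lemma exists_subseq_tendsto_ae_of_cauchy {f : ℕ → α → ℝ} (hf : ∀ n, Integrable (f n) μ)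
    (hcauchy : ∀ ε > 0, ∃ n₀, ∀ m ≥ n₀, ∀ n ≥ n₀, ∫ x, |f m x - f n x| ∂μ < ε) :
    ∃ g : α → ℝ, Tendsto (fun n => ∫ x, f n x ∂μ) atTop (𝓝 (∫ x, g x ∂μ)) ∧
      ∃ k : ℕ → ℕ, StrictMono k ∧ ∀ᵐ x ∂μ, Tendsto (fun n => f (k n) x) atTop (𝓝 (g x)) := by
  let F : ℕ → (α →₁[μ] ℝ) := fun n => (hf n).toL1
  have hF : CauchySeq F := by
    refine Metric.cauchySeq_iff.2 fun ε hε => ?_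
    obtain ⟨n₀, hn₀⟩ := hcauchy ε hε
    refine ⟨n₀, fun m hm n hn => ?_⟩
    rw [dist_eq_norm, ← Integrable.toL1_sub, L1.norm_of_fun_eq_integral_norm]
    exact hn₀ m hm n hn
  obtain ⟨g, hg⟩ := cauchySeq_tendsto_of_complete hF
  obtain ⟨k, hk, hkg⟩ := (tendstoInMeasure_of_tendsto_Lp hg).exists_seq_tendsto_ae
  refine ⟨g, ?_, k, hk, ?_⟩
  · exact ((continuous_integral.tendsto g).comp hg).congr fun n =>
      integral_congr_ae (hf n).coeFn_toL1
  · filter_upwards [hkg, ae_all_iff.2 fun n => (hf n).coeFn_toL1] with x hx hfx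
    exact hx.congr fun n => hfx (k n)

lemma sq_integral_mul_le_integral_mul_sq {r f : α → ℝ} (hr : 0 ≤ r) (hr1 : ∫ x, r x ∂μ = 1)
    (hf : Integrable (fun x => r x * f x) μ) (hf2 : Integrable (fun x => r x * f x ^ 2) μ) :
    (∫ x, r x * f x ∂μ) ^ 2 ≤ ∫ x, r x * f x ^ 2 ∂μ := by
  have hrI : Integrable r μ := Integrable.of_integral_ne_zero (by simp [hr1])
  let m := ∫ x, r x * f x ∂μ
  have hvar : ∫ x, r x * (f x - m) ^ 2 ∂μ = (∫ x, r x * f x ^ 2 ∂μ) - m ^ 2 := by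
    calc ∫ x, r x * (f x - m) ^ 2 ∂μ
        = ∫ x, (r x * f x ^ 2 - 2 * m * (r x * f x) + m ^ 2 * r x) ∂μ := by
          congr 1 with x
          ring
      _ = (∫ x, r x * f x ^ 2 ∂μ) - 2 * m * m + m ^ 2 * 1 := by
          have hfm := hf.const_mul (2 * m)
          rw [integral_add (by exact hf2.sub hfm) (hrI.const_mul _), integral_sub hf2 hfm,
            integral_const_mul, integral_const_mul, hr1]
      _ = _ := by ring
  have hvar0 : 0 ≤ ∫ x, r x * (f x - m) ^ 2 ∂μ :=
    integral_nonneg fun x => mul_nonneg (hr x) (sq_nonneg _)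
  exact sub_nonneg.1 (hvar ▸ hvar0)

lemma lintegral_prod_mul_sub {G : Type*} [AddGroup G] [MeasurableSpace G] [MeasurableAdd₂ G]
    [MeasurableNeg G] {μ : Measure G} [SFinite μ] [μ.IsAddRightInvariant] {i g : G → ℝ≥0∞}
    (hi : Measurable i) (hg : Measurable g) :
    ∫⁻ p, i p.1 * g (p.2 - p.1) ∂μ.prod μ = (∫⁻ x, i x ∂μ) * ∫⁻ h, g h ∂μ := by
  have hinner (x : G) : ∫⁻ y, i x * g (y - x) ∂μ = i x * ∫⁻ h, g h ∂μ := by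
    rw [lintegral_const_mul _ (by fun_prop), lintegral_sub_right_eq_self]
  rw [lintegral_prod _ (by fun_prop), lintegral_congr hinner, lintegral_mul_const _ hi]

end MeasureTheory

lemma exists_tendsto_sub_of_antitone_convex {E : Type*} [AddCommGroup E] [Module ℝ E] {Q : E → ℝ}
    {K : ℕ → Set E} (hKanti : Antitone K) (hK : ∀ n, Convex ℝ (K n)) {f : ℕ → E}
    (hf : ∀ n, f n ∈ K n) (hQ : ∀ x, 0 ≤ Q x) {C : ℝ} (hC : ∀ n, Q (f n) ≤ C)
    (hpar : ∀ x ∈ K 0, ∀ y ∈ K 0, Q (x - y) = 2 * Q x + 2 * Q y - 4 * Q (midpoint ℝ x y)) :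
    ∃ g : ℕ → E, (∀ n, g n ∈ K n) ∧
      Tendsto (fun p : ℕ × ℕ => Q (g p.1 - g p.2)) atTop (𝓝 0) := by
  let d : ℕ → ℝ := fun n => sInf (Q '' K n)
  have hbdd (n : ℕ) : BddBelow (Q '' K n) := ⟨0, Set.forall_mem_image.2 fun x _ => hQ x⟩
  have hne (n : ℕ) : (Q '' K n).Nonempty := ⟨_, f n, hf n, rfl⟩
  have hd {n : ℕ} {x : E} (hx : x ∈ K n) : d n ≤ Q x := csInf_le (hbdd n) ⟨x, hx, rfl⟩
  have hdmono : Monotone d := fun n m hnm =>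
    csInf_le_csInf (hbdd n) (hne m) (Set.image_mono (hKanti hnm))
  have hdlim : Tendsto d atTop (𝓝 (⨆ n, d n)) :=
    tendsto_atTop_ciSup hdmono ⟨C, Set.forall_mem_range.2 fun n => (hd (hf n)).trans (hC n)⟩
  have hnear (n : ℕ) : ∃ x ∈ K n, Q x < d n + 1 / ((n : ℝ) + 1) := by
    simpa using exists_lt_of_csInf_lt (hne n) (lt_add_of_pos_right (d n) Nat.one_div_pos_of_nat)
  choose g hgK hgd using hnear
  have hglim : Tendsto (fun n => Q (g n)) atTop (𝓝 (⨆ n, d n)) :=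
    tendsto_of_tendsto_of_tendsto_of_le_of_le hdlim
      (by simpa using hdlim.add tendsto_one_div_add_atTop_nhds_zero_nat)
      (fun n => hd (hgK n)) (fun n => (hgd n).le)
  have hmin : Tendsto (fun p : ℕ × ℕ => min p.1 p.2) atTop atTop :=
    tendsto_atTop.2 fun b => (eventually_ge_atTop (b, b)).mono fun p hp => le_min hp.1 hp.2
  refine ⟨g, hgK, squeeze_zero (fun p => hQ _) (fun p => ?_) ?_
    (g := fun p => 2 * Q (g p.1) + 2 * Q (g p.2) - 4 * d (min p.1 p.2))⟩
  · rw [hpar _ (hKanti (Nat.zero_le _) (hgK _)) _ (hKanti (Nat.zero_le _) (hgK _))]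
    have hmid : midpoint ℝ (g p.1) (g p.2) ∈ K (min p.1 p.2) :=
      (hK _).midpoint_mem (hKanti (min_le_left _ _) (hgK _)) (hKanti (min_le_right _ _) (hgK _))
    linarith [hd hmid]
  · rw [show (0 : ℝ) = 2 * (⨆ n, d n) + 2 * (⨆ n, d n) - 4 * (⨆ n, d n) by ring]
    rw [← prod_atTop_atTop_eq] at hmin ⊢
    exact (((hglim.comp tendsto_fst).const_mul 2).add ((hglim.comp tendsto_snd).const_mul 2)).sub
      ((hdlim.comp hmin).const_mul 4)

lemma rpow_half_mul_self {x : ℝ} (hx : 0 ≤ x) (a : ℝ) : x ^ (a / 2) * x ^ (a / 2) = x ^ a := by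
  rw [← pow_two, ← Real.rpow_mul_natCast hx]
  congr 1
  push_cast
  ring

variable {N : ℕ} {s q : ℝ}

local notation "𝔼" n:max => EuclideanSpace ℝ (Fin n)

variable {u v w : 𝔼 N → ℝ} {Ω : Set (𝔼 N)}

/-- The difference quotient `(u(x) - u(y)) / |x - y|^((N + 2s) / 2)`, with the value `0` on the
diagonal. Its squared `L²` norm is the energy. -/
noncomputable def diffQuot (s : ℝ) (u : 𝔼 N → ℝ) (p : 𝔼 N × 𝔼 N) : ℝ :=
  (u p.1 - u p.2) / ‖p.1 - p.2‖ ^ (((N : ℝ) + 2 * s) / 2)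

lemma diffQuot_add (s : ℝ) (u v : 𝔼 N → ℝ) :
    diffQuot s (u + v) = diffQuot s u + diffQuot s v := by
  ext p
  simp only [diffQuot, Pi.add_apply]
  ring

lemma diffQuot_smul (s c : ℝ) (u : 𝔼 N → ℝ) : diffQuot s (c • u) = c • diffQuot s u := by
  ext p
  simp only [diffQuot, Pi.smul_apply, smul_eq_mul]
  ring

lemma diffQuot_neg (s : ℝ) (u : 𝔼 N → ℝ) : diffQuot s (-u) = -diffQuot s u := by
  simpa using diffQuot_smul s (-1) u

lemma diffQuot_sub (s : ℝ) (u v : 𝔼 N → ℝ) :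
    diffQuot s (u - v) = diffQuot s u - diffQuot s v := by
  rw [sub_eq_add_neg, diffQuot_add, diffQuot_neg, ← sub_eq_add_neg]

lemma diffQuot_mul_diffQuot (s : ℝ) (u v : 𝔼 N → ℝ) (p : 𝔼 N × 𝔼 N) :
    diffQuot s u p * diffQuot s v p =
      (u p.1 - u p.2) * (v p.1 - v p.2) / ‖p.1 - p.2‖ ^ ((N : ℝ) + 2 * s) := by
  rw [diffQuot, diffQuot, div_mul_div_comm, rpow_half_mul_self (norm_nonneg _)]

lemma diffQuot_sq (s : ℝ) (u : 𝔼 N → ℝ) (p : 𝔼 N × 𝔼 N) :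
    diffQuot s u p ^ 2 = (u p.1 - u p.2) ^ 2 / ‖p.1 - p.2‖ ^ ((N : ℝ) + 2 * s) := by
  rw [pow_two, diffQuot_mul_diffQuot, pow_two]

lemma energy_eq_lintegral (s : ℝ) (u : 𝔼 N → ℝ) :
    energy s u = ∫⁻ p, ENNReal.ofReal (diffQuot s u p ^ 2) := by
  simp only [energy, diffQuot_sq]

lemma energy_eq_eLpNorm_sq (s : ℝ) (u : 𝔼 N → ℝ) :
    energy s u = eLpNorm (diffQuot s u) 2 volume ^ 2 := by
  rw [energy_eq_lintegral, eLpNorm_eq_lintegral_rpow_enorm_toReal two_ne_zero ENNReal.ofNat_ne_top]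
  simp only [ENNReal.toReal_ofNat, ENNReal.rpow_ofNat, one_div, ← ENNReal.rpow_mul_natCast,
    Nat.cast_ofNat, inv_mul_cancel₀ (two_ne_zero' ℝ), ENNReal.rpow_one]
  refine lintegral_congr fun p => ?_
  rw [← ofReal_norm, ← ENNReal.ofReal_pow (norm_nonneg _), Real.norm_eq_abs, sq_abs]

lemma energyForm_eq_integral (s : ℝ) (u v : 𝔼 N → ℝ) :
    energyForm s u v = ∫ p, diffQuot s u p * diffQuot s v p := by
  simp only [energyForm, diffQuot_mul_diffQuot]

lemma aemeasurable_diffQuot (s : ℝ) (hu : AEMeasurable u) : AEMeasurable (diffQuot s u) :=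
  ((hu.comp_quasiMeasurePreserving Measure.quasiMeasurePreserving_fst).sub
    (hu.comp_quasiMeasurePreserving Measure.quasiMeasurePreserving_snd)).div (by fun_prop)

lemma diffQuot_congr (h : u =ᵐ[volume] v) : diffQuot s u =ᵐ[volume] diffQuot s v := by
  filter_upwards [ae_prod_of_ae h h] with p hp
  rw [diffQuot, diffQuot, hp.1, hp.2]

lemma energy_congr (h : u =ᵐ[volume] v) : energy s u = energy s v := by
  rw [energy_eq_eLpNorm_sq, energy_eq_eLpNorm_sq, eLpNorm_congr_ae (diffQuot_congr h)]

lemma energyForm_congr {u' v' : 𝔼 N → ℝ} (hu : u =ᵐ[volume] u') (hv : v =ᵐ[volume] v') :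
    energyForm s u v = energyForm s u' v' := by
  rw [energyForm_eq_integral, energyForm_eq_integral]
  exact integral_congr_ae ((diffQuot_congr hu).mul (diffQuot_congr hv))

lemma energyForm_comm (s : ℝ) (u v : 𝔼 N → ℝ) : energyForm s u v = energyForm s v u := by
  simp only [energyForm_eq_integral, mul_comm]

lemma energyForm_smul_left (s c : ℝ) (u v : 𝔼 N → ℝ) :
    energyForm s (c • u) v = c * energyForm s u v := by
  simp only [energyForm_eq_integral, diffQuot_smul, Pi.smul_apply, smul_eq_mul, mul_assoc]
  exact integral_const_mul _ _

lemma energyForm_smul_right (s c : ℝ) (u v : 𝔼 N → ℝ) :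
    energyForm s u (c • v) = c * energyForm s u v := by
  rw [energyForm_comm, energyForm_smul_left, energyForm_comm]

lemma energyForm_self_nonneg (s : ℝ) (u : 𝔼 N → ℝ) : 0 ≤ energyForm s u u := by
  rw [energyForm_eq_integral]
  exact integral_nonneg fun p => mul_self_nonneg _

/-- Functions with square integrable difference quotient: those for which `energy s u < ⊤` and
`energyForm s u u` is not a junk value. -/
def HasFiniteEnergy (s : ℝ) (u : 𝔼 N → ℝ) : Prop :=
  MemLp (diffQuot s u) 2 volume

lemma hasFiniteEnergy_of_lt_top (hu : AEMeasurable u) (h : energy s u < ⊤) :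
    HasFiniteEnergy s u := by
  rw [energy_eq_eLpNorm_sq] at h
  exact ⟨(aemeasurable_diffQuot s hu).aestronglyMeasurable,
    (ENNReal.pow_lt_top_iff.1 h).resolve_right two_ne_zero⟩

namespace HasFiniteEnergy

lemma energy_lt_top (hu : HasFiniteEnergy s u) : energy s u < ⊤ := by
  rw [energy_eq_eLpNorm_sq]
  exact ENNReal.pow_lt_top hu.2

lemma smul (hu : HasFiniteEnergy s u) (c : ℝ) : HasFiniteEnergy s (c • u) := by
  rw [HasFiniteEnergy, diffQuot_smul]
  exact MemLp.const_smul hu c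

lemma add (hu : HasFiniteEnergy s u) (hv : HasFiniteEnergy s v) : HasFiniteEnergy s (u + v) := by
  rw [HasFiniteEnergy, diffQuot_add]
  exact MemLp.add hu hv

lemma sub (hu : HasFiniteEnergy s u) (hv : HasFiniteEnergy s v) : HasFiniteEnergy s (u - v) := by
  rw [HasFiniteEnergy, diffQuot_sub]
  exact MemLp.sub hu hv

lemma integrable_mul (hu : HasFiniteEnergy s u) (hv : HasFiniteEnergy s v) :
    Integrable (fun p => diffQuot s u p * diffQuot s v p) :=
  MemLp.integrable_mul hu hv

lemma energy_eq_ofReal (hu : HasFiniteEnergy s u) :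
    energy s u = ENNReal.ofReal (energyForm s u u) := by
  rw [energyForm_eq_integral, ofReal_integral_eq_lintegral_ofReal (hu.integrable_mul hu)
    (Eventually.of_forall fun p => mul_self_nonneg _), energy_eq_lintegral]
  simp only [pow_two]

lemma toReal_energy (hu : HasFiniteEnergy s u) : (energy s u).toReal = energyForm s u u := by
  rw [hu.energy_eq_ofReal, ENNReal.toReal_ofReal (energyForm_self_nonneg s u)]

lemma energyForm_add_left (hu : HasFiniteEnergy s u) (hv : HasFiniteEnergy s v)
    (hw : HasFiniteEnergy s w) :
    energyForm s (u + v) w = energyForm s u w + energyForm s v w := by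
  simp only [energyForm_eq_integral, diffQuot_add, Pi.add_apply, add_mul]
  exact integral_add (hu.integrable_mul hw) (hv.integrable_mul hw)

lemma energyForm_add_self (hu : HasFiniteEnergy s u) (hv : HasFiniteEnergy s v) :
    energyForm s (u + v) (u + v) =
      energyForm s u u + 2 * energyForm s u v + energyForm s v v := by
  rw [hu.energyForm_add_left hv (hu.add hv), energyForm_comm s u, energyForm_comm s v,
    hu.energyForm_add_left hv hu, hu.energyForm_add_left hv hv, energyForm_comm s v u]
  ring

lemma energyForm_sub_self (hu : HasFiniteEnergy s u) (hv : HasFiniteEnergy s v) :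
    energyForm s (u - v) (u - v) = 2 * energyForm s u u + 2 * energyForm s v v -
      4 * energyForm s (midpoint ℝ u v) (midpoint ℝ u v) := by
  rw [show u - v = u + (-1 : ℝ) • v by module, midpoint_eq_smul_add, energyForm_smul_left,
    energyForm_smul_right, hu.energyForm_add_self hv, hu.energyForm_add_self (hv.smul _)]
  simp only [energyForm_smul_left, energyForm_smul_right, invOf_eq_inv]
  ring

end HasFiniteEnergy

lemma energy_le_liminf {f : ℕ → 𝔼 N → ℝ} (hf : ∀ n, AEMeasurable (f n))
    (h : ∀ᵐ x, Tendsto (fun n => f n x) atTop (𝓝 (u x))) :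
    energy s u ≤ liminf (fun n => energy s (f n)) atTop := by
  simp only [energy_eq_lintegral]
  calc ∫⁻ p, ENNReal.ofReal (diffQuot s u p ^ 2)
      = ∫⁻ p, liminf (fun n => ENNReal.ofReal (diffQuot s (f n) p ^ 2)) atTop := by
        refine lintegral_congr_ae ?_
        filter_upwards [ae_prod_of_ae h h] with p hp
        refine (Tendsto.liminf_eq ?_).symm
        exact ENNReal.tendsto_ofReal (((hp.1.sub hp.2).div_const _).pow 2)
    _ ≤ _ := lintegral_liminf_le' fun n =>
        ((aemeasurable_diffQuot s (hf n)).pow_const 2).ennreal_ofReal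

lemma energy_comp_prodMk_le {K : NNReal} {F : ℝ × ℝ → ℝ} (hF : LipschitzWith K F)
    (hu : AEMeasurable u) :
    energy s (fun x => F (u x, v x)) ≤ (K : ℝ≥0∞) ^ 2 * (energy s u + energy s v) := by
  simp only [energy_eq_lintegral]
  rw [← lintegral_add_left' ((aemeasurable_diffQuot s hu).pow_const 2).ennreal_ofReal,
    ← lintegral_const_mul' _ _ (by simp)]
  refine lintegral_mono fun p => ?_
  rw [← ENNReal.ofReal_add (sq_nonneg _) (sq_nonneg _), ← ENNReal.ofReal_coe_nnreal,
    ← ENNReal.ofReal_pow K.coe_nonneg, ← ENNReal.ofReal_mul (by positivity)]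
  refine ENNReal.ofReal_le_ofReal ?_
  rw [diffQuot_sq, diffQuot_sq, diffQuot_sq, ← add_div, ← mul_div_assoc]
  gcongr
  have hdist : |F (u p.1, v p.1) - F (u p.2, v p.2)| ≤
      K * max |u p.1 - u p.2| |v p.1 - v p.2| := hF.dist_le_mul _ _
  calc (F (u p.1, v p.1) - F (u p.2, v p.2)) ^ 2
      ≤ (K * max |u p.1 - u p.2| |v p.1 - v p.2|) ^ 2 := sq_le_sq.2 (hdist.trans (le_abs_self _))
    _ ≤ K ^ 2 * ((u p.1 - u p.2) ^ 2 + (v p.1 - v p.2) ^ 2) := by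
        rw [mul_pow]
        gcongr
        rcases max_choice |u p.1 - u p.2| |v p.1 - v p.2| with h | h <;> rw [h, sq_abs] <;>
          linarith [sq_nonneg (u p.1 - u p.2), sq_nonneg (v p.1 - v p.2)]

lemma integrable_min_sq_div_norm_rpow (N : ℕ) (hs : s ∈ Set.Ioo (0 : ℝ) 1) :
    Integrable fun h : 𝔼 N => min (‖h‖ ^ 2) 1 / ‖h‖ ^ ((N : ℝ) + 2 * s) := by
  rcases N.eq_zero_or_pos with rfl | hN
  · exact Integrable.of_finite
  have : Nonempty (Fin N) := ⟨⟨0, hN⟩⟩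
  refine (integrable_fun_norm_addHaar (volume : Measure (𝔼 N))
    (f := fun r : ℝ => min (r ^ 2) 1 / r ^ ((N : ℝ) + 2 * s))).2 ?_
  rw [finrank_euclideanSpace_fin, ← Set.Ioc_union_Ioi_eq_Ioi (zero_le_one (α := ℝ))]
  have hcast (r : ℝ) : r ^ (N - 1) = r ^ ((N : ℝ) - 1) := by
    rw [← Real.rpow_natCast, Nat.cast_sub hN, Nat.cast_one]
  refine IntegrableOn.union ?_ ?_
  · have hint : IntegrableOn (fun r : ℝ => r ^ (1 - 2 * s)) (Set.Ioc 0 1) := by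
      rw [← intervalIntegrable_iff_integrableOn_Ioc_of_le zero_le_one]
      exact intervalIntegral.intervalIntegrable_rpow' (by linarith [hs.2])
    refine hint.congr_fun (fun r hr => ?_) measurableSet_Ioc
    simp only [smul_eq_mul]
    rw [hcast, min_eq_left (pow_le_one₀ hr.1.le hr.2), ← Real.rpow_two, ← Real.rpow_sub hr.1,
      ← Real.rpow_add hr.1]
    congr 1
    ring
  · have hint : IntegrableOn (fun r : ℝ => r ^ (-1 - 2 * s)) (Set.Ioi 1) :=
      integrableOn_Ioi_rpow_of_lt (by linarith [hs.1]) one_pos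
    refine hint.congr_fun (fun r hr => ?_) measurableSet_Ioi
    have hr0 : 0 < r := one_pos.trans hr
    simp only [smul_eq_mul]
    rw [hcast, min_eq_right (one_le_pow₀ (le_of_lt hr)), one_div, ← Real.rpow_neg hr0.le,
      ← Real.rpow_add hr0]
    congr 1
    ring

lemma exists_sq_sub_le_mul_min {E : Type*} [SeminormedAddCommGroup E] {u : E → ℝ} {K : NNReal}
    (hu : LipschitzWith K u) {M : ℝ} (hM : ∀ x, ‖u x‖ ≤ M) :
    ∃ C ≥ 0, ∀ x y, (u x - u y) ^ 2 ≤ C * min (‖x - y‖ ^ 2) 1 := by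
  refine ⟨max ((K : ℝ) ^ 2) ((M + M) ^ 2), by positivity, fun x y => ?_⟩
  have hlip : |u x - u y| ≤ K * ‖x - y‖ := hu.norm_sub_le x y
  have hbdd : |u x - u y| ≤ M + M := (norm_sub_le _ _).trans (add_le_add (hM x) (hM y))
  rw [mul_min_of_nonneg _ _ (by positivity), le_min_iff, mul_one]
  constructor
  · calc (u x - u y) ^ 2 ≤ (K * ‖x - y‖) ^ 2 := sq_le_sq.2 (hlip.trans (le_abs_self _))
      _ ≤ max ((K : ℝ) ^ 2) ((M + M) ^ 2) * ‖x - y‖ ^ 2 := by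
        rw [mul_pow]
        gcongr
        exact le_max_left _ _
  · exact (sq_le_sq.2 (hbdd.trans (le_abs_self _))).trans (le_max_right _ _)

lemma energy_lt_top_of_lipschitzWith (hs : s ∈ Set.Ioo (0 : ℝ) 1) {K : NNReal}
    (hu : LipschitzWith K u) (hc : HasCompactSupport u) : energy s u < ⊤ := by
  obtain ⟨M, hM⟩ := hc.exists_bound_of_continuous hu.continuous
  obtain ⟨C, _, hle⟩ := exists_sq_sub_le_mul_min hu hM
  let i : 𝔼 N → ℝ≥0∞ := (tsupport u).indicator 1
  let g : 𝔼 N → ℝ≥0∞ := fun h =>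
    ENNReal.ofReal (C * (min (‖h‖ ^ 2) 1 / ‖h‖ ^ ((N : ℝ) + 2 * s)))
  have hi : Measurable i := measurable_one.indicator (isClosed_tsupport u).measurableSet
  have hg : Measurable g := by fun_prop
  have hint : ∫⁻ p : 𝔼 N × 𝔼 N, i p.1 * g (p.2 - p.1) < ⊤ := by
    rw [Measure.volume_eq_prod, lintegral_prod_mul_sub hi hg,
      lintegral_indicator_one (isClosed_tsupport u).measurableSet]
    exact ENNReal.mul_lt_top hc.measure_lt_top
      ((integrable_min_sq_div_norm_rpow N hs).const_mul C).lintegral_lt_top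
  have hswap : ∫⁻ p : 𝔼 N × 𝔼 N, i p.2 * g (p.1 - p.2) =
      ∫⁻ p : 𝔼 N × 𝔼 N, i p.1 * g (p.2 - p.1) := by
    rw [Measure.volume_eq_prod]
    exact lintegral_prod_swap fun p : 𝔼 N × 𝔼 N => i p.1 * g (p.2 - p.1)
  have hpt (p : 𝔼 N × 𝔼 N) :
      ENNReal.ofReal ((u p.1 - u p.2) ^ 2 / ‖p.1 - p.2‖ ^ ((N : ℝ) + 2 * s)) ≤
        i p.1 * g (p.2 - p.1) + i p.2 * g (p.1 - p.2) := by
    have hg' : g (p.2 - p.1) = g (p.1 - p.2) := by simp only [g, norm_sub_rev]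
    have hle' : ENNReal.ofReal ((u p.1 - u p.2) ^ 2 / ‖p.1 - p.2‖ ^ ((N : ℝ) + 2 * s)) ≤
        g (p.1 - p.2) := by
      simp only [g, ← mul_div_assoc]
      gcongr
      exact hle _ _
    rw [hg', ← add_mul]
    by_cases hp : p.1 ∈ tsupport u ∨ p.2 ∈ tsupport u
    · refine hle'.trans (le_mul_of_one_le_left' ?_)
      rcases hp with hp | hp <;> simp [i, hp]
    · rw [not_or] at hp
      simp [image_eq_zero_of_notMem_tsupport hp.1, image_eq_zero_of_notMem_tsupport hp.2]
  refine (lintegral_mono hpt).trans_lt ?_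
  rw [lintegral_add_left (by fun_prop), hswap]
  exact ENNReal.add_lt_top.2 ⟨hint, hint⟩

lemma energy_comp_sub_right (s : ℝ) (u : 𝔼 N → ℝ) (z : 𝔼 N) :
    energy s (fun x => u (x - z)) = energy s u := by
  simp only [energy, Measure.volume_eq_prod]
  rw [← lintegral_sub_right_eq_self (fun p : 𝔼 N × 𝔼 N =>
    ENNReal.ofReal ((u p.1 - u p.2) ^ 2 / ‖p.1 - p.2‖ ^ ((N : ℝ) + 2 * s))) (z, z)]
  simp only [Prod.fst_sub, Prod.snd_sub, sub_sub_sub_cancel_right]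

open scoped Convolution in
lemma energy_convolution_le {r : 𝔼 N → ℝ} (hr : Continuous r) (hrc : HasCompactSupport r)
    (hr0 : 0 ≤ r) (hr1 : ∫ z, r z = 1) (hu : Continuous u) :
    energy s (r ⋆[ContinuousLinearMap.lsmul ℝ ℝ, volume] u) ≤ energy s u := by
  have hint {f : 𝔼 N → ℝ} (hf : Continuous f) : Integrable fun z => r z * f z :=
    (hr.mul hf).integrable_of_hasCompactSupport hrc.mul_right
  let D : 𝔼 N → 𝔼 N × 𝔼 N → ℝ := fun z => diffQuot s fun x => u (x - z)
  have hD (p : 𝔼 N × 𝔼 N) : Continuous fun z => D z p := by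
    unfold D diffQuot
    fun_prop
  have hD2 (p : 𝔼 N × 𝔼 N) : Integrable fun z => r z * D z p ^ 2 := hint (by fun_prop)
  have hconv (p : 𝔼 N × 𝔼 N) :
      diffQuot s (r ⋆[ContinuousLinearMap.lsmul ℝ ℝ, volume] u) p = ∫ z, r z * D z p := by
    simp only [D, diffQuot, convolution_def, ContinuousLinearMap.lsmul_apply, smul_eq_mul,
      ← mul_div_assoc, mul_sub, integral_div]
    rw [integral_sub (hint (by fun_prop)) (hint (by fun_prop))]
  have hmeas : Measurable fun x : (𝔼 N × 𝔼 N) × 𝔼 N =>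
      ENNReal.ofReal (r x.2) * ENNReal.ofReal (D x.2 x.1 ^ 2) := by
    have := hu.measurable
    have := hr.measurable
    unfold D diffQuot
    fun_prop
  simp only [energy_eq_lintegral s (r ⋆[_, _] u), hconv]
  calc ∫⁻ p, ENNReal.ofReal ((∫ z, r z * D z p) ^ 2)
      ≤ ∫⁻ p, ENNReal.ofReal (∫ z, r z * D z p ^ 2) := by
        refine lintegral_mono fun p => ENNReal.ofReal_le_ofReal ?_
        exact sq_integral_mul_le_integral_mul_sq hr0 hr1 (hint (hD p)) (hD2 p)
    _ = ∫⁻ p, ∫⁻ z, ENNReal.ofReal (r z) * ENNReal.ofReal (D z p ^ 2) := by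
        refine lintegral_congr fun p => ?_
        rw [ofReal_integral_eq_lintegral_ofReal (hD2 p)
          (Eventually.of_forall fun z => mul_nonneg (hr0 z) (sq_nonneg _))]
        simp only [ENNReal.ofReal_mul (hr0 _)]
    _ = ∫⁻ z, ENNReal.ofReal (r z) * energy s u := by
        rw [lintegral_lintegral_swap hmeas.aemeasurable]
        refine lintegral_congr fun z => ?_
        rw [lintegral_const_mul' _ _ ENNReal.ofReal_ne_top, ← energy_eq_lintegral,
          energy_comp_sub_right]
    _ = energy s u := by
        rw [lintegral_mul_const _ hr.measurable.ennreal_ofReal,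
          ← ofReal_integral_eq_lintegral_ofReal (hr.integrable_of_hasCompactSupport hrc)
            (Eventually.of_forall hr0), hr1, ENNReal.ofReal_one, one_mul]

namespace IsTestFunction

lemma continuous (hu : IsTestFunction Ω u) : Continuous u := hu.1.continuous

lemma eq_zero_of_notMem (hu : IsTestFunction Ω u) {x : 𝔼 N} (hx : x ∉ Ω) : u x = 0 :=
  image_eq_zero_of_notMem_tsupport fun h => hx (hu.2.2 h)

lemma hasFiniteEnergy (hs : s ∈ Set.Ioo (0 : ℝ) 1) (hu : IsTestFunction Ω u) :
    HasFiniteEnergy s u := by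
  obtain ⟨K, hK⟩ := ContDiff.lipschitzWith_of_hasCompactSupport hu.2.1 hu.1 (by simp)
  exact hasFiniteEnergy_of_lt_top hu.continuous.aemeasurable
    (energy_lt_top_of_lipschitzWith hs hK hu.2.1)

lemma add (hu : IsTestFunction Ω u) (hv : IsTestFunction Ω v) : IsTestFunction Ω (u + v) :=
  ⟨hu.1.add hv.1, hu.2.1.add hv.2.1, (tsupport_add u v).trans (Set.union_subset hu.2.2 hv.2.2)⟩

lemma smul (hu : IsTestFunction Ω u) (c : ℝ) : IsTestFunction Ω (c • u) :=
  ⟨contDiff_const.smul hu.1, hu.2.1.smul_left,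
    (tsupport_smul_subset_right (fun _ => c) u).trans hu.2.2⟩

end IsTestFunction

lemma convex_setOf_isTestFunction (Ω : Set (𝔼 N)) : Convex ℝ {φ | IsTestFunction Ω φ} :=
  fun _ hφ _ hψ a b _ _ _ => (IsTestFunction.smul hφ a).add (IsTestFunction.smul hψ b)

open scoped Convolution Pointwise in
lemma exists_isTestFunction_approx (hΩ : IsOpen Ω) (hu : Continuous u) (hc : HasCompactSupport u)
    (hsub : tsupport u ⊆ Ω) (s : ℝ) {ε : ℝ} (hε : 0 < ε) :
    ∃ φ, IsTestFunction Ω φ ∧ (∀ x, |φ x - u x| ≤ ε) ∧ energy s φ ≤ energy s u := by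
  obtain ⟨δ₁, hδ₁, hunif⟩ := Metric.uniformContinuous_iff.1
    (hc.uniformContinuous_of_continuous hu) ε hε
  obtain ⟨δ₂, hδ₂, hthick⟩ := IsCompact.exists_cthickening_subset_open hc hΩ hsub
  have hδ : 0 < min δ₁ δ₂ := lt_min hδ₁ hδ₂
  let ρ : ContDiffBump (0 : 𝔼 N) := ⟨min δ₁ δ₂ / 2, min δ₁ δ₂, half_pos hδ, half_lt_self hδ⟩
  refine ⟨ρ.normed volume ⋆[ContinuousLinearMap.lsmul ℝ ℝ, volume] u, ⟨?_, ?_, ?_⟩, fun x => ?_,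
    energy_convolution_le ρ.continuous_normed ρ.hasCompactSupport_normed ρ.nonneg_normed
      ρ.integral_normed hu⟩
  · exact ρ.hasCompactSupport_normed.contDiff_convolution_left _ ρ.contDiff_normed
      hu.locallyIntegrable
  · exact ρ.hasCompactSupport_normed.convolution _ hc
  · refine (closure_minimal ?_ Metric.isClosed_cthickening).trans hthick
    refine (support_convolution_subset _).trans ?_
    rintro _ ⟨a, ha, b, hb, rfl⟩
    rw [ρ.support_normed_eq, mem_ball_zero_iff] at ha
    refine Metric.mem_cthickening_of_dist_le _ b _ _ (subset_tsupport u hb) ?_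
    rw [dist_eq_norm, add_sub_cancel_right]
    exact ha.le.trans (min_le_right _ _)
  · rw [← Real.dist_eq]
    refine ρ.dist_normed_convolution_le hu.aestronglyMeasurable fun y hy => ?_
    exact (hunif ((Metric.mem_ball.1 hy).trans_le (min_le_left _ _))).le

lemma tendsto_apply_of_mem_convexHull_tail {ι : Type*} {f g : ℕ → ι → ℝ}
    (hg : ∀ n, g n ∈ convexHull ℝ (f '' Set.Ici n)) {x : ι} {a : ℝ}
    (h : Tendsto (fun n => f n x) atTop (𝓝 a)) : Tendsto (fun n => g n x) atTop (𝓝 a) := by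
  rw [Metric.tendsto_atTop] at h ⊢
  intro ε hε
  obtain ⟨n₀, hn₀⟩ := h ε hε
  refine ⟨n₀, fun n hn => ?_⟩
  refine convexHull_min (t := {φ | φ x ∈ Metric.ball a ε}) ?_ ?_ (hg n)
  · rintro _ ⟨k, hk, rfl⟩
    exact hn₀ k (hn.trans hk)
  · exact (convex_ball a ε).linear_preimage (LinearMap.proj (R := ℝ) (φ := fun _ : ι => ℝ) x)

lemma mem_D0_of_cauchy {φ : ℕ → 𝔼 N → ℝ} (hφ : ∀ n, IsTestFunction Ω (φ n))
    (hcauchy : Tendsto (fun p : ℕ × ℕ => energy s (φ p.1 - φ p.2)) atTop (𝓝 0))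
    (h : ∀ᵐ x, Tendsto (fun n => φ n x) atTop (𝓝 (u x))) : u ∈ D0 Ω s := by
  refine ⟨φ, hφ, ENNReal.tendsto_atTop_zero.2 fun ε hε => ?_, h⟩
  obtain ⟨⟨n₀, m₀⟩, hle⟩ := eventually_atTop.1 (hcauchy.eventually_le_const hε)
  refine ⟨n₀, fun n hn => ?_⟩
  calc energy s (φ n - u) ≤ liminf (fun m => energy s (φ n - φ m)) atTop := by
        refine energy_le_liminf
          (fun m => ((hφ n).continuous.sub (hφ m).continuous).aemeasurable) ?_
        filter_upwards [h] with x hx using tendsto_const_nhds.sub hx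
    _ ≤ ε := liminf_le_of_frequently_le'
        ((eventually_ge_atTop m₀).mono fun m hm => hle (n, m) ⟨hn, hm⟩).frequently

/-- Convex combinations of mollifications of the `f n` are test functions that form a Cauchy
sequence in energy. -/
lemma mem_D0_of_tendsto (hs : s ∈ Set.Ioo (0 : ℝ) 1) (hΩ : IsOpen Ω) {f : ℕ → 𝔼 N → ℝ}
    (hf : ∀ n, Continuous (f n)) (hc : ∀ n, HasCompactSupport (f n))
    (hsub : ∀ n, tsupport (f n) ⊆ Ω) {C : ℝ≥0∞} (hC : C ≠ ⊤) (hfC : ∀ n, energy s (f n) ≤ C)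
    (h : ∀ᵐ x, Tendsto (fun n => f n x) atTop (𝓝 (u x))) : u ∈ D0 Ω s := by
  choose φ hφ hφf hφe using fun n => exists_isTestFunction_approx hΩ (hf n) (hc n) (hsub n) s
    (Nat.one_div_pos_of_nat (α := ℝ) (n := n))
  have hφu : ∀ᵐ x, Tendsto (fun n => φ n x) atTop (𝓝 (u x)) := by
    filter_upwards [h] with x hx
    have hdiff : Tendsto (fun n => φ n x - f n x) atTop (𝓝 0) :=
      squeeze_zero_norm (fun n => hφf n x) tendsto_one_div_add_atTop_nhds_zero_nat
    simpa using hdiff.add hx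
  have hhull (n : ℕ) : convexHull ℝ (φ '' Set.Ici n) ⊆ {ψ | IsTestFunction Ω ψ} :=
    convexHull_min (by rintro _ ⟨k, -, rfl⟩; exact hφ k) (convex_setOf_isTestFunction Ω)
  obtain ⟨g, hg, hcauchy⟩ := exists_tendsto_sub_of_antitone_convex
    (K := fun n => convexHull ℝ (φ '' Set.Ici n)) (Q := fun w => energyForm s w w) (f := φ)
    (C := C.toReal)
    (fun n m hnm => convexHull_mono (Set.image_mono (Set.Ici_subset_Ici.2 hnm)))
    (fun n => convex_convexHull ℝ _)
    (fun n => subset_convexHull _ _ ⟨n, Set.self_mem_Ici, rfl⟩) (energyForm_self_nonneg s)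
    (fun n => ((hφ n).hasFiniteEnergy hs).toReal_energy.symm.trans_le
      (ENNReal.toReal_mono hC ((hφe n).trans (hfC n))))
    (fun w hw w' hw' => ((hhull 0 hw).hasFiniteEnergy hs).energyForm_sub_self
      ((hhull 0 hw').hasFiniteEnergy hs))
  have hgt (n : ℕ) : IsTestFunction Ω (g n) := hhull n (hg n)
  refine mem_D0_of_cauchy hgt ?_ ?_
  · simp_rw [fun p : ℕ × ℕ =>
      (((hgt p.1).hasFiniteEnergy hs).sub ((hgt p.2).hasFiniteEnergy hs)).energy_eq_ofReal]
    simpa using ENNReal.tendsto_ofReal hcauchy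
  · filter_upwards [hφu] with x hx using tendsto_apply_of_mem_convexHull_tail hg hx

lemma aemeasurable_of_mem_D0 (hu : u ∈ D0 Ω s) : AEMeasurable u := by
  obtain ⟨φ, hφ, -, h⟩ := hu
  exact aemeasurable_of_tendsto_metrizable_ae atTop (fun n => (hφ n).continuous.aemeasurable) h

lemma ae_eq_zero_of_mem_D0 (hu : u ∈ D0 Ω s) : ∀ᵐ x, x ∉ Ω → u x = 0 := by
  obtain ⟨φ, hφ, -, h⟩ := hu
  filter_upwards [h] with x hx hxΩ
  refine tendsto_nhds_unique hx ?_
  simp only [fun n => (hφ n).eq_zero_of_notMem hxΩ, tendsto_const_nhds]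

lemma D0_congr (hu : u ∈ D0 Ω s) (h : u =ᵐ[volume] v) : v ∈ D0 Ω s := by
  obtain ⟨φ, hφ, he, hae⟩ := hu
  refine ⟨φ, hφ, he.congr fun n => energy_congr (EventuallyEq.rfl.sub h), ?_⟩
  filter_upwards [h, hae] with x hx hφx
  rwa [← hx]

lemma IsTestFunction.mem_D0 (hu : IsTestFunction Ω u) : u ∈ D0 Ω s :=
  ⟨fun _ => u, fun _ => hu, by simp [energy], Eventually.of_forall fun _ => tendsto_const_nhds⟩

lemma hasFiniteEnergy_of_mem_D0 (hs : s ∈ Set.Ioo (0 : ℝ) 1) (hu : u ∈ D0 Ω s) :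
    HasFiniteEnergy s u := by
  have hm := aemeasurable_of_mem_D0 hu
  obtain ⟨φ, hφ, he, -⟩ := hu
  obtain ⟨n, hn⟩ := (he.eventually_lt_const ENNReal.zero_lt_top).exists
  have hsub : HasFiniteEnergy s (φ n - u) :=
    hasFiniteEnergy_of_lt_top ((hφ n).continuous.aemeasurable.sub hm) hn
  rw [← sub_sub_cancel (φ n) u]
  exact ((hφ n).hasFiniteEnergy hs).sub hsub

lemma tendsto_energy {f : ℕ → 𝔼 N → ℝ} (hf : ∀ n, AEMeasurable (f n))
    (he : Tendsto (fun n => energy s (f n - u)) atTop (𝓝 0))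
    (hae : ∀ᵐ x, Tendsto (fun n => f n x) atTop (𝓝 (u x))) :
    Tendsto (fun n => energy s (f n)) atTop (𝓝 (energy s u)) := by
  have hu : AEMeasurable u := aemeasurable_of_tendsto_metrizable_ae atTop hf hae
  have hle (n : ℕ) : energy s (f n) ≤
      (eLpNorm (diffQuot s u) 2 volume + energy s (f n - u) ^ (1 / 2 : ℝ)) ^ 2 := by
    rw [energy_eq_eLpNorm_sq, energy_eq_eLpNorm_sq, ← ENNReal.rpow_natCast_mul, Nat.cast_ofNat,
      mul_one_div_cancel two_ne_zero, ENNReal.rpow_one]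
    gcongr
    calc eLpNorm (diffQuot s (f n)) 2 volume
        = eLpNorm (diffQuot s u + diffQuot s (f n - u)) 2 volume := by
          rw [← diffQuot_add, add_sub_cancel]
      _ ≤ _ := eLpNorm_add_le (aemeasurable_diffQuot s hu).aestronglyMeasurable
          (aemeasurable_diffQuot s ((hf n).sub hu)).aestronglyMeasurable one_le_two
  have hlim : Tendsto (fun n => (eLpNorm (diffQuot s u) 2 volume +
      energy s (f n - u) ^ (1 / 2 : ℝ)) ^ 2) atTop (𝓝 (energy s u)) := by
    have hsqrt := (ENNReal.continuous_rpow_const (y := (1 / 2 : ℝ))).tendsto 0 |>.comp he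
    rw [ENNReal.zero_rpow_of_pos (by positivity)] at hsqrt
    simpa only [Function.comp_def, add_zero, ← energy_eq_eLpNorm_sq] using
      ENNReal.Tendsto.pow (n := 2) (hsqrt.const_add (eLpNorm (diffQuot s u) 2 volume))
  exact tendsto_of_le_liminf_of_limsup_le (energy_le_liminf hf hae)
    ((limsup_le_limsup (Eventually.of_forall hle)).trans hlim.limsup_eq.le)

lemma exists_isTestFunction_energy_le (hs : s ∈ Set.Ioo (0 : ℝ) 1) (hu : u ∈ D0 Ω s) :
    ∃ φ : ℕ → 𝔼 N → ℝ, (∀ n, IsTestFunction Ω (φ n)) ∧ (∀ n, energy s (φ n) ≤ energy s u + 1) ∧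
      ∀ᵐ x, Tendsto (fun n => φ n x) atTop (𝓝 (u x)) := by
  have hlt : energy s u < energy s u + 1 :=
    ENNReal.lt_add_right (hasFiniteEnergy_of_mem_D0 hs hu).energy_lt_top.ne one_ne_zero
  obtain ⟨φ, hφ, he, hae⟩ := hu
  obtain ⟨n₀, hn₀⟩ := eventually_atTop.1
    ((tendsto_energy (fun n => (hφ n).continuous.aemeasurable) he hae).eventually_le_const hlt)
  refine ⟨fun n => φ (n + n₀), fun n => hφ _, fun n => hn₀ _ (Nat.le_add_left _ _), ?_⟩
  filter_upwards [hae] with x hx using hx.comp (tendsto_add_atTop_nat n₀)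

lemma tsupport_comp_prodMk_subset {F : ℝ × ℝ → ℝ} (hF : F (0, 0) = 0) :
    tsupport (fun x => F (u x, v x)) ⊆ tsupport u ∪ tsupport v := by
  refine closure_minimal (fun x hx => ?_) ((isClosed_tsupport u).union (isClosed_tsupport v))
  contrapose! hx
  rw [Set.mem_union, not_or] at hx
  simp [image_eq_zero_of_notMem_tsupport hx.1, image_eq_zero_of_notMem_tsupport hx.2, hF]

section Operations

variable (hs : s ∈ Set.Ioo (0 : ℝ) 1) (hΩ : IsOpen Ω) (hu : u ∈ D0 Ω s) (hv : v ∈ D0 Ω s)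

include hs hΩ hu hv

lemma comp_prodMk_mem_D0 {K : NNReal} {F : ℝ × ℝ → ℝ} (hF : LipschitzWith K F)
    (hF0 : F (0, 0) = 0) : (fun x => F (u x, v x)) ∈ D0 Ω s := by
  obtain ⟨φ, hφ, hφe, hφu⟩ := exists_isTestFunction_energy_le hs hu
  obtain ⟨ψ, hψ, hψe, hψv⟩ := exists_isTestFunction_energy_le hs hv
  have hufin := (hasFiniteEnergy_of_mem_D0 hs hu).energy_lt_top.ne
  have hvfin := (hasFiniteEnergy_of_mem_D0 hs hv).energy_lt_top.ne
  refine mem_D0_of_tendsto hs hΩ (f := fun n x => F (φ n x, ψ n x))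
    (C := (K : ℝ≥0∞) ^ 2 * ((energy s u + 1) + (energy s v + 1)))
    (fun n => hF.continuous.comp ((hφ n).continuous.prodMk (hψ n).continuous))
    (fun n => (hφ n).2.1.comp₂_left (hψ n).2.1 (m := fun a b => F (a, b)) hF0)
    (fun n => (tsupport_comp_prodMk_subset hF0).trans (Set.union_subset (hφ n).2.2 (hψ n).2.2))
    (by finiteness) (fun n => ?_) ?_
  · refine (energy_comp_prodMk_le hF (hφ n).continuous.aemeasurable).trans ?_
    gcongr
    exacts [hφe n, hψe n]
  · filter_upwards [hφu, hψv] with x hx hy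
    exact (hF.continuous.tendsto _).comp (hx.prodMk_nhds hy)

lemma add_mem_D0 : u + v ∈ D0 Ω s :=
  comp_prodMk_mem_D0 hs hΩ hu hv (F := fun p => p.1 + p.2)
    (LipschitzWith.prod_fst.add LipschitzWith.prod_snd) (add_zero 0)

lemma sup_mem_D0 : u ⊔ v ∈ D0 Ω s :=
  comp_prodMk_mem_D0 hs hΩ hu hv (F := fun p => max p.1 p.2) lipschitzWith_max (max_self 0)

lemma inf_mem_D0 : u ⊓ v ∈ D0 Ω s :=
  comp_prodMk_mem_D0 hs hΩ hu hv (F := fun p => min p.1 p.2) lipschitzWith_min (min_self 0)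

omit hv

lemma smul_mem_D0 (c : ℝ) : c • u ∈ D0 Ω s :=
  comp_prodMk_mem_D0 hs hΩ hu hu (F := fun p => c • p.1)
    ((lipschitzWith_smul c).comp LipschitzWith.prod_fst) (smul_zero c)

lemma abs_mem_D0 : |u| ∈ D0 Ω s := by
  rw [abs, ← neg_one_smul ℝ u]
  exact sup_mem_D0 hs hΩ hu (smul_mem_D0 hs hΩ hu (-1))

end Operations

lemma energy_smul (s c : ℝ) (u : 𝔼 N → ℝ) :
    energy s (c • u) = ENNReal.ofReal (c ^ 2) * energy s u := by
  simp only [energy_eq_lintegral, diffQuot_smul, Pi.smul_apply, smul_eq_mul, mul_pow,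
    ENNReal.ofReal_mul (sq_nonneg c)]
  exact lintegral_const_mul' _ _ ENNReal.ofReal_ne_top

lemma exists_isTestFunction_eventually_ne_zero (hΩ : IsOpen Ω) {x : 𝔼 N} (hx : x ∈ Ω) :
    ∃ φ, IsTestFunction Ω φ ∧ ∀ᶠ y in 𝓝 x, φ y ≠ 0 := by
  obtain ⟨r, hr, hrΩ⟩ := Metric.nhds_basis_closedBall.mem_iff.1 (hΩ.mem_nhds hx)
  let ρ : ContDiffBump x := ⟨r / 2, r, half_pos hr, half_lt_self hr⟩
  refine ⟨ρ, ⟨ρ.contDiff, ρ.hasCompactSupport, ?_⟩, ?_⟩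
  · rwa [ρ.tsupport_eq]
  · filter_upwards [Metric.ball_mem_nhds x hr] with y hy using (ρ.pos_of_mem_ball hy).ne'

lemma abs_rpow_nonneg (a b : ℝ) : 0 ≤ |a| ^ b := Real.rpow_nonneg (abs_nonneg a) b

lemma integral_abs_rpow_nonneg (Ω : Set (𝔼 N)) (q : ℝ) (u : 𝔼 N → ℝ) :
    0 ≤ ∫ x in Ω, |u x| ^ q :=
  integral_nonneg fun _ => abs_rpow_nonneg _ _

lemma integral_abs_smul_rpow (Ω : Set (𝔼 N)) (q c : ℝ) (u : 𝔼 N → ℝ) :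
    ∫ x in Ω, |(c • u) x| ^ q = |c| ^ q * ∫ x in Ω, |u x| ^ q := by
  simp only [Pi.smul_apply, smul_eq_mul, abs_mul, Real.mul_rpow (abs_nonneg _) (abs_nonneg _),
    integral_const_mul]

lemma integral_abs_normalised_rpow (hq : 0 < q) (h : 0 < ∫ x in Ω, |u x| ^ q) :
    ∫ x in Ω, |(((∫ x in Ω, |u x| ^ q) ^ (-1 / q)) • u) x| ^ q = 1 := by
  rw [integral_abs_smul_rpow, abs_of_pos (Real.rpow_pos_of_pos h _), ← Real.rpow_mul h.le,
    div_mul_cancel₀ _ hq.ne', Real.rpow_neg_one, inv_mul_cancel₀ h.ne']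

namespace IsTestFunction

lemma continuous_abs_rpow (hu : IsTestFunction Ω u) (hq : 0 < q) :
    Continuous fun x => |u x| ^ q :=
  hu.continuous.abs.rpow_const fun _ => Or.inr hq.le

lemma hasCompactSupport_abs_rpow (hu : IsTestFunction Ω u) (hq : 0 < q) :
    HasCompactSupport fun x => |u x| ^ q :=
  hu.2.1.comp_left (g := fun t => |t| ^ q) (by simp [hq.ne'])

lemma integrable_abs_rpow (hu : IsTestFunction Ω u) (hq : 0 < q) :
    Integrable fun x => |u x| ^ q :=
  (hu.continuous_abs_rpow hq).integrable_of_hasCompactSupport (hu.hasCompactSupport_abs_rpow hq)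

lemma integral_abs_rpow_pos (hu : IsTestFunction Ω u) (hq : 0 < q) {x : 𝔼 N} (hx : u x ≠ 0) :
    0 < ∫ y in Ω, |u y| ^ q := by
  rw [setIntegral_eq_integral_of_forall_compl_eq_zero fun y hy => by
    rw [hu.eq_zero_of_notMem hy, abs_zero, Real.zero_rpow hq.ne']]
  exact (hu.continuous_abs_rpow hq).integral_pos_of_hasCompactSupport_nonneg_nonzero
    (hu.hasCompactSupport_abs_rpow hq) (fun y => abs_rpow_nonneg _ _)
    (Real.rpow_pos_of_pos (abs_pos.2 hx) q).ne'

lemma lambdaOne_le (hu : IsTestFunction Ω u) (hq : 0 < q) (h : 0 < ∫ x in Ω, |u x| ^ q) :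
    lambdaOne Ω s q ≤ ENNReal.ofReal ((∫ x in Ω, |u x| ^ q) ^ (-2 / q)) * energy s u := by
  have hle : lambdaOne Ω s q ≤ energy s ((∫ x in Ω, |u x| ^ q) ^ (-1 / q) • u) :=
    sInf_le ⟨_, hu.smul _, integral_abs_normalised_rpow hq h, rfl⟩
  rwa [energy_smul, ← Real.rpow_mul_natCast h.le,
    show -1 / q * (2 : ℕ) = -2 / q by push_cast; ring] at hle

end IsTestFunction

lemma lambdaOne_ne_top (hs : s ∈ Set.Ioo (0 : ℝ) 1) (hΩ : IsOpen Ω) (hne : Ω.Nonempty)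
    (hq : 0 < q) : lambdaOne Ω s q ≠ ⊤ := by
  obtain ⟨x, hx⟩ := hne
  obtain ⟨φ, hφ, hφx⟩ := exists_isTestFunction_eventually_ne_zero hΩ hx
  exact ne_top_of_le_ne_top
    (ENNReal.mul_ne_top ENNReal.ofReal_ne_top (hφ.hasFiniteEnergy hs).energy_lt_top.ne)
    (hφ.lambdaOne_le hq (hφ.integral_abs_rpow_pos hq hφx.self_of_nhds))

lemma ofReal_integral_abs_rpow (h : IntegrableOn (fun x => |u x| ^ q) Ω) :
    ENNReal.ofReal (∫ x in Ω, |u x| ^ q) = ∫⁻ x in Ω, ENNReal.ofReal (|u x| ^ q) :=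
  ofReal_integral_eq_lintegral_ofReal h (Eventually.of_forall fun _ => abs_rpow_nonneg _ _)

section Poincare

variable (hs : s ∈ Set.Ioo (0 : ℝ) 1) (hq : 0 < q) (hpos : 0 < lambdaOne Ω s q)

include hs hq hpos

lemma IsTestFunction.lintegral_abs_rpow_le (hu : IsTestFunction Ω u) :
    ∫⁻ x in Ω, ENNReal.ofReal (|u x| ^ q) ≤ (energy s u / lambdaOne Ω s q) ^ (q / 2) := by
  rw [← ofReal_integral_abs_rpow (hu.integrable_abs_rpow hq).integrableOn]
  rcases (integral_abs_rpow_nonneg Ω q u).eq_or_lt with h | h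
  · simp [← h]
  set m := ∫ x in Ω, |u x| ^ q
  have hm : m ^ (2 / q) * m ^ (-2 / q) = 1 := by
    rw [← Real.rpow_add h, ← add_div, add_neg_cancel, zero_div, Real.rpow_zero]
  have hle : ENNReal.ofReal (m ^ (2 / q)) ≤ energy s u / lambdaOne Ω s q := by
    rw [ENNReal.le_div_iff_mul_le (.inl hpos.ne')
      (.inr (hu.hasFiniteEnergy hs).energy_lt_top.ne)]
    calc ENNReal.ofReal (m ^ (2 / q)) * lambdaOne Ω s q
        ≤ ENNReal.ofReal (m ^ (2 / q)) * (ENNReal.ofReal (m ^ (-2 / q)) * energy s u) := by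
          gcongr
          exact hu.lambdaOne_le hq h
      _ = energy s u := by
          rw [← mul_assoc, ← ENNReal.ofReal_mul (by positivity), hm, ENNReal.ofReal_one, one_mul]
  calc ENNReal.ofReal m = ENNReal.ofReal (m ^ (2 / q)) ^ (q / 2) := by
        rw [ENNReal.ofReal_rpow_of_nonneg (by positivity) (by positivity), ← Real.rpow_mul h.le,
          div_mul_div_cancel₀ hq.ne', div_self two_ne_zero, Real.rpow_one]
    _ ≤ _ := by gcongr

lemma lintegral_abs_rpow_le (hu : u ∈ D0 Ω s) :
    ∫⁻ x in Ω, ENNReal.ofReal (|u x| ^ q) ≤ (energy s u / lambdaOne Ω s q) ^ (q / 2) := by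
  obtain ⟨φ, hφ, hφe, hφu⟩ := hu
  calc ∫⁻ x in Ω, ENNReal.ofReal (|u x| ^ q)
      = ∫⁻ x in Ω, liminf (fun n => ENNReal.ofReal (|φ n x| ^ q)) atTop := by
        refine lintegral_congr_ae (ae_restrict_of_ae ?_)
        filter_upwards [hφu] with x hx
        exact (ENNReal.tendsto_ofReal (hx.abs.rpow_const (Or.inr hq.le))).liminf_eq.symm
    _ ≤ liminf (fun n => ∫⁻ x in Ω, ENNReal.ofReal (|φ n x| ^ q)) atTop :=
        lintegral_liminf_le fun n =>
          ((hφ n).continuous_abs_rpow hq).measurable.ennreal_ofReal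
    _ ≤ liminf (fun n => (energy s (φ n) / lambdaOne Ω s q) ^ (q / 2)) atTop :=
        liminf_le_liminf (Eventually.of_forall fun n =>
          (hφ n).lintegral_abs_rpow_le hs hq hpos)
    _ = (energy s u / lambdaOne Ω s q) ^ (q / 2) := by
        have he := tendsto_energy (fun n => (hφ n).continuous.aemeasurable) hφe hφu
        exact ((ENNReal.continuous_rpow_const.tendsto _).comp
          (ENNReal.Tendsto.div_const he (.inr hpos.ne'))).liminf_eq

lemma integrableOn_abs_rpow (hu : u ∈ D0 Ω s) : IntegrableOn (fun x => |u x| ^ q) Ω := by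
  refine ⟨((aemeasurable_of_mem_D0 hu).restrict.abs.pow_const q).aestronglyMeasurable, ?_⟩
  rw [hasFiniteIntegral_iff_ofReal (Eventually.of_forall fun _ => abs_rpow_nonneg _ _)]
  refine (lintegral_abs_rpow_le hs hq hpos hu).trans_lt
    (ENNReal.rpow_lt_top_of_nonneg (by positivity) ?_)
  exact ENNReal.div_ne_top (hasFiniteEnergy_of_mem_D0 hs hu).energy_lt_top.ne hpos.ne'

lemma toReal_lambdaOne_mul_le_energyForm (hu : u ∈ D0 Ω s) :
    (lambdaOne Ω s q).toReal * (∫ x in Ω, |u x| ^ q) ^ (2 / q) ≤ energyForm s u u := by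
  have hufin := hasFiniteEnergy_of_mem_D0 hs hu
  have hm := integral_abs_rpow_nonneg Ω q u
  have hle : ENNReal.ofReal (∫ x in Ω, |u x| ^ q) ^ (2 / q) ≤
      energy s u / lambdaOne Ω s q := by
    rw [ofReal_integral_abs_rpow (integrableOn_abs_rpow hs hq hpos hu), ← inv_div,
      ENNReal.rpow_inv_le_iff (by positivity)]
    exact lintegral_abs_rpow_le hs hq hpos hu
  have hmul := ENNReal.toReal_mono hufin.energy_lt_top.ne (ENNReal.mul_le_of_le_div hle)
  rwa [ENNReal.toReal_mul, ← ENNReal.toReal_rpow, ENNReal.toReal_ofReal hm,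
    hufin.toReal_energy, mul_comm] at hmul

lemma lambdaOne_le_energy (hu : u ∈ constraintSet Ω s q) : lambdaOne Ω s q ≤ energy s u := by
  have hle := lintegral_abs_rpow_le hs hq hpos hu.1
  rw [← ofReal_integral_abs_rpow (integrableOn_abs_rpow hs hq hpos hu.1), hu.2,
    ENNReal.ofReal_one, ← ENNReal.rpow_inv_le_iff (by positivity), ENNReal.one_rpow] at hle
  simpa using ENNReal.mul_le_of_le_div hle

end Poincare

lemma sq_max_sub_max_add_sq_min_sub_min (a b c d : ℝ) :
    (max a c - max b d) ^ 2 + (min a c - min b d) ^ 2 +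
      2 * (max (a - c) 0 * max (d - b) 0 + max (c - a) 0 * max (b - d) 0) =
      (a - b) ^ 2 + (c - d) ^ 2 := by
  rcases le_total a c with h1 | h1 <;> rcases le_total b d with h2 | h2 <;>
    simp only [max_eq_left, max_eq_right, min_eq_left, min_eq_right, h1, h2, sub_nonneg.2 h1,
      sub_nonneg.2 h2, sub_nonpos.2 h1, sub_nonpos.2 h2] <;> ring

lemma diffQuot_sup_sq_add_inf_sq_le (s : ℝ) (u v : 𝔼 N → ℝ) (p : 𝔼 N × 𝔼 N) :
    diffQuot s (u ⊔ v) p ^ 2 + diffQuot s (u ⊓ v) p ^ 2 ≤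
      diffQuot s u p ^ 2 + diffQuot s v p ^ 2 := by
  simp only [diffQuot_sq, ← add_div, Pi.sup_apply, Pi.inf_apply]
  gcongr ?_ / _
  rw [← sq_max_sub_max_add_sq_min_sub_min (u p.1) (u p.2) (v p.1) (v p.2)]
  exact le_add_of_nonneg_right (by positivity)

lemma diffQuot_sup_sq_add_inf_sq_lt (s : ℝ) {p : 𝔼 N × 𝔼 N} (h₁ : v p.1 < u p.1)
    (h₂ : u p.2 < v p.2) :
    diffQuot s (u ⊔ v) p ^ 2 + diffQuot s (u ⊓ v) p ^ 2 <
      diffQuot s u p ^ 2 + diffQuot s v p ^ 2 := by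
  have hne : p.1 ≠ p.2 := fun he => lt_asymm h₁ (he ▸ h₂)
  have hnorm : 0 < ‖p.1 - p.2‖ := norm_pos_iff.2 (sub_ne_zero.2 hne)
  have hpos : 0 < max (u p.1 - v p.1) 0 * max (v p.2 - u p.2) 0 :=
    mul_pos (lt_max_of_lt_left (sub_pos.2 h₁)) (lt_max_of_lt_left (sub_pos.2 h₂))
  simp only [diffQuot_sq, ← add_div, Pi.sup_apply, Pi.inf_apply]
  gcongr ?_ / _
  rw [← sq_max_sub_max_add_sq_min_sub_min (u p.1) (u p.2) (v p.1) (v p.2)]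
  exact lt_add_of_pos_right _ (mul_pos two_pos (add_pos_of_pos_of_nonneg hpos (by positivity)))

lemma energy_add_energy (hu : AEMeasurable u) (v : 𝔼 N → ℝ) :
    energy s u + energy s v =
      ∫⁻ p, ENNReal.ofReal (diffQuot s u p ^ 2 + diffQuot s v p ^ 2) := by
  simp only [energy_eq_lintegral, ENNReal.ofReal_add (sq_nonneg _) (sq_nonneg _)]
  exact (lintegral_add_left' ((aemeasurable_diffQuot s hu).pow_const 2).ennreal_ofReal _).symm

lemma energy_sup_add_energy_inf_le (hu : AEMeasurable u) (hv : AEMeasurable v) :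
    energy s (u ⊔ v) + energy s (u ⊓ v) ≤ energy s u + energy s v := by
  rw [energy_add_energy (hu.sup hv), energy_add_energy hu]
  exact lintegral_mono fun p => ENNReal.ofReal_le_ofReal (diffQuot_sup_sq_add_inf_sq_le s u v p)

lemma ae_le_or_ae_le_of_energy_le (hu : AEMeasurable u) (hv : AEMeasurable v)
    (hfin : energy s u + energy s v ≠ ⊤)
    (h : energy s u + energy s v ≤ energy s (u ⊔ v) + energy s (u ⊓ v)) :
    (∀ᵐ x, u x ≤ v x) ∨ ∀ᵐ x, v x ≤ u x := by
  have hle := energy_sup_add_energy_inf_le (s := s) hu hv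
  rw [energy_add_energy (hu.sup hv), energy_add_energy hu] at *
  have hae := ae_eq_of_ae_le_of_lintegral_le (ae_of_all _ fun p =>
      ENNReal.ofReal_le_ofReal (diffQuot_sup_sq_add_inf_sq_le s u v p))
    (ne_top_of_le_ne_top hfin hle)
    (((aemeasurable_diffQuot s hu).pow_const 2).add
      ((aemeasurable_diffQuot s hv).pow_const 2)).ennreal_ofReal h
  have hcross : ∀ᵐ p : 𝔼 N × 𝔼 N, ¬ (v p.1 < u p.1 ∧ u p.2 < v p.2) := by
    filter_upwards [hae] with p hp ⟨h₁, h₂⟩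
    refine ((ENNReal.ofReal_lt_ofReal_iff ?_).2 (diffQuot_sup_sq_add_inf_sq_lt s h₁ h₂)).ne hp
    exact (by positivity : (0 : ℝ) ≤ _).trans_lt (diffQuot_sup_sq_add_inf_sq_lt s h₁ h₂)
  simpa only [not_lt] using
    ae_not_or_ae_not_of_ae_prod (P := fun x => v x < u x) (R := fun x => u x < v x) hcross

lemma energy_abs_le (s : ℝ) (u : 𝔼 N → ℝ) : energy s |u| ≤ energy s u := by
  simp only [energy_eq_lintegral, diffQuot_sq, Pi.abs_apply]
  gcongr ∫⁻ _, ENNReal.ofReal (?_ / _) with p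
  exact sq_le_sq.2 (abs_abs_sub_abs_le (u p.1) (u p.2))

lemma two_le_rpow_add_rpow {r A B : ℝ} (hr : 1 ≤ r) (hA : 0 ≤ A) (hB : 0 ≤ B)
    (hAB : A + B = 2) : 2 ≤ A ^ r + B ^ r := by
  have h := (convexOn_rpow hr).2 hA hB one_half_pos.le one_half_pos.le (add_halves 1)
  simp only [smul_eq_mul, ← mul_add, hAB] at h
  norm_num at h
  linarith

lemma two_lt_rpow_add_rpow {r A B : ℝ} (hr : 1 < r) (hA : 0 ≤ A) (hB : 0 ≤ B)
    (hAB : A + B = 2) (hne : A ≠ B) : 2 < A ^ r + B ^ r := by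
  have h := (strictConvexOn_rpow hr).2 hA hB hne one_half_pos one_half_pos (add_halves 1)
  simp only [smul_eq_mul, ← mul_add, hAB] at h
  norm_num at h
  linarith

lemma exists_abs_sub_lt_of_rpow_add_rpow_lt {r : ℝ} (hr : 1 < r) {η : ℝ} (hη : 0 < η) :
    ∃ ε > 0, ∀ A B : ℝ, 0 ≤ A → 0 ≤ B → A + B = 2 → A ^ r + B ^ r < 2 + ε → |A - B| < η := by
  let S : Set (ℝ × ℝ) :=
    (Set.Icc 0 2 ×ˢ Set.Icc 0 2) ∩ ({p | p.1 + p.2 = 2} ∩ {p | η ≤ |p.1 - p.2|})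
  have hS : IsCompact S := (isCompact_Icc.prod isCompact_Icc).inter_right
    ((isClosed_eq (by fun_prop) (by fun_prop)).inter (isClosed_le (by fun_prop) (by fun_prop)))
  have hcont : Continuous fun p : ℝ × ℝ => p.1 ^ r + p.2 ^ r :=
    (continuous_fst.rpow_const fun _ => .inr (by positivity)).add
      (continuous_snd.rpow_const fun _ => .inr (by positivity))
  obtain ⟨m, hm, hmS⟩ := hS.exists_forall_le' (a := 2) hcont.continuousOn fun p hp =>
    two_lt_rpow_add_rpow hr hp.1.1.1 hp.1.2.1 hp.2.1 fun he => by
      have hdist : η ≤ |p.1 - p.2| := hp.2.2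
      rw [he, sub_self, abs_zero] at hdist
      exact hdist.not_gt hη
  refine ⟨m - 2, sub_pos.2 hm, fun A B hA hB hAB h => ?_⟩
  by_contra! hη'
  have := hmS (A, B) ⟨⟨⟨hA, by linarith⟩, hB, by linarith⟩, hAB, hη'⟩
  linarith

lemma abs_rpow_max_sub_abs_rpow_min {a b : ℝ} (ha : 0 ≤ a) (hb : 0 ≤ b) (hq : 0 ≤ q) :
    |max a b| ^ q - |min a b| ^ q = |(|a| ^ q - |b| ^ q)| := by
  wlog h : a ≤ b generalizing a b
  · rw [max_comm, min_comm, abs_sub_comm, this hb ha (le_of_not_ge h)]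
  rw [max_eq_right h, min_eq_left h, abs_sub_comm, abs_of_nonneg ha, abs_of_nonneg hb,
    abs_of_nonneg (sub_nonneg.2 (Real.rpow_le_rpow ha h hq))]

section Lattice

variable (hs : s ∈ Set.Ioo (0 : ℝ) 1) (hΩ : IsOpen Ω) (hq : 0 < q)
  (hpos : 0 < lambdaOne Ω s q) (hu : u ∈ D0 Ω s) (hv : v ∈ D0 Ω s)

include hs hΩ hu hv

lemma energyForm_sup_add_energyForm_inf_le :
    energyForm s (u ⊔ v) (u ⊔ v) + energyForm s (u ⊓ v) (u ⊓ v) ≤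
      energyForm s u u + energyForm s v v := by
  have h := energy_sup_add_energy_inf_le (s := s) (aemeasurable_of_mem_D0 hu)
    (aemeasurable_of_mem_D0 hv)
  rwa [(hasFiniteEnergy_of_mem_D0 hs hu).energy_eq_ofReal,
    (hasFiniteEnergy_of_mem_D0 hs hv).energy_eq_ofReal,
    (hasFiniteEnergy_of_mem_D0 hs (sup_mem_D0 hs hΩ hu hv)).energy_eq_ofReal,
    (hasFiniteEnergy_of_mem_D0 hs (inf_mem_D0 hs hΩ hu hv)).energy_eq_ofReal,
    ← ENNReal.ofReal_add (energyForm_self_nonneg s _) (energyForm_self_nonneg s _),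
    ← ENNReal.ofReal_add (energyForm_self_nonneg s _) (energyForm_self_nonneg s _),
    ENNReal.ofReal_le_ofReal_iff
      (add_nonneg (energyForm_self_nonneg s _) (energyForm_self_nonneg s _))] at h

include hq hpos

lemma integral_sup_rpow_add_integral_inf_rpow :
    (∫ x in Ω, |(u ⊔ v) x| ^ q) + ∫ x in Ω, |(u ⊓ v) x| ^ q =
      (∫ x in Ω, |u x| ^ q) + ∫ x in Ω, |v x| ^ q := by
  rw [← integral_add (integrableOn_abs_rpow hs hq hpos (sup_mem_D0 hs hΩ hu hv))
      (integrableOn_abs_rpow hs hq hpos (inf_mem_D0 hs hΩ hu hv)),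
    ← integral_add (integrableOn_abs_rpow hs hq hpos hu) (integrableOn_abs_rpow hs hq hpos hv)]
  congr 1 with x
  exact fn_max_add_fn_min (fun t => |t| ^ q) (u x) (v x)

lemma toReal_lambdaOne_mul_sup_add_inf_le :
    (lambdaOne Ω s q).toReal *
        ((∫ x in Ω, |(u ⊔ v) x| ^ q) ^ (2 / q) + (∫ x in Ω, |(u ⊓ v) x| ^ q) ^ (2 / q)) ≤
      energyForm s (u ⊔ v) (u ⊔ v) + energyForm s (u ⊓ v) (u ⊓ v) := by
  rw [mul_add]
  exact add_le_add (toReal_lambdaOne_mul_le_energyForm hs hq hpos (sup_mem_D0 hs hΩ hu hv))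
    (toReal_lambdaOne_mul_le_energyForm hs hq hpos (inf_mem_D0 hs hΩ hu hv))

lemma integral_abs_rpow_sub_rpow (hu0 : 0 ≤ u) (hv0 : 0 ≤ v) :
    ∫ x in Ω, |(|u x| ^ q - |v x| ^ q)| =
      (∫ x in Ω, |(u ⊔ v) x| ^ q) - ∫ x in Ω, |(u ⊓ v) x| ^ q := by
  rw [← integral_sub (integrableOn_abs_rpow hs hq hpos (sup_mem_D0 hs hΩ hu hv))
    (integrableOn_abs_rpow hs hq hpos (inf_mem_D0 hs hΩ hu hv))]
  congr 1 with x
  exact (abs_rpow_max_sub_abs_rpow_min (hu0 x) (hv0 x) hq.le).symm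

end Lattice

section Existence

variable (hs : s ∈ Set.Ioo (0 : ℝ) 1) (hΩ : IsOpen Ω) (hq : 0 < q) (hq2 : q < 2)
  (hpos : 0 < lambdaOne Ω s q) (hfin : lambdaOne Ω s q ≠ ⊤)

include hs hΩ hq hq2 hpos hfin

lemma exists_integral_abs_rpow_sub_rpow_lt {η : ℝ} (hη : 0 < η) :
    ∃ δ > 0, ∀ u ∈ constraintSet Ω s q, ∀ v ∈ constraintSet Ω s q, 0 ≤ u → 0 ≤ v →
      energyForm s u u < (lambdaOne Ω s q).toReal + δ →
      energyForm s v v < (lambdaOne Ω s q).toReal + δ →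
      ∫ x in Ω, |(|u x| ^ q - |v x| ^ q)| < η := by
  have hL := ENNReal.toReal_pos hpos.ne' hfin
  obtain ⟨ε, hε, h⟩ := exists_abs_sub_lt_of_rpow_add_rpow_lt ((one_lt_div hq).2 hq2) hη
  refine ⟨(lambdaOne Ω s q).toReal * ε / 2, by positivity,
    fun u ⟨hu, hu1⟩ v ⟨hv, hv1⟩ hu0 hv0 hue hve => ?_⟩
  rw [integral_abs_rpow_sub_rpow hs hΩ hq hpos hu hv hu0 hv0]
  refine (le_abs_self _).trans_lt (h _ _ (integral_abs_rpow_nonneg Ω q _)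
    (integral_abs_rpow_nonneg Ω q _) ?_ (lt_of_mul_lt_mul_left ?_ hL.le))
  · rw [integral_sup_rpow_add_integral_inf_rpow hs hΩ hq hpos hu hv, hu1, hv1, one_add_one_eq_two]
  · calc (lambdaOne Ω s q).toReal *
          ((∫ x in Ω, |(u ⊔ v) x| ^ q) ^ (2 / q) + (∫ x in Ω, |(u ⊓ v) x| ^ q) ^ (2 / q))
        ≤ energyForm s u u + energyForm s v v :=
          (toReal_lambdaOne_mul_sup_add_inf_le hs hΩ hq hpos hu hv).trans
            (energyForm_sup_add_energyForm_inf_le hs hΩ hu hv)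
      _ < (lambdaOne Ω s q).toReal * (2 + ε) := by linarith

lemma exists_subseq_tendsto_ae_of_minimising {ψ : ℕ → 𝔼 N → ℝ}
    (hψ : ∀ n, ψ n ∈ constraintSet Ω s q) (hψ0 : ∀ n, 0 ≤ ψ n)
    (hlim : Tendsto (fun n => energyForm s (ψ n) (ψ n)) atTop (𝓝 (lambdaOne Ω s q).toReal)) :
    ∃ u : 𝔼 N → ℝ, ∫ x in Ω, |u x| ^ q = 1 ∧ ∃ k : ℕ → ℕ, StrictMono k ∧
      ∀ᵐ x, Tendsto (fun n => ψ (k n) x) atTop (𝓝 (u x)) := by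
  obtain ⟨g, hg, k, hk, hkg⟩ := exists_subseq_tendsto_ae_of_cauchy
    (fun n => integrableOn_abs_rpow hs hq hpos (hψ n).1) fun η hη => by
      obtain ⟨δ, hδ, hclose⟩ := exists_integral_abs_rpow_sub_rpow_lt hs hΩ hq hq2 hpos hfin hη
      obtain ⟨n₀, hn₀⟩ := eventually_atTop.1
        (hlim.eventually_lt_const (lt_add_of_pos_right _ hδ))
      exact ⟨n₀, fun m hm n hn =>
        hclose _ (hψ m) _ (hψ n) (hψ0 m) (hψ0 n) (hn₀ m hm) (hn₀ n hn)⟩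
  have hg1 : ∫ x in Ω, g x = 1 := tendsto_nhds_unique hg (by simp [fun n => (hψ n).2])
  refine ⟨Ω.indicator fun x => g x ^ (1 / q), ?_, k, hk, ?_⟩
  · refine (integral_congr_ae ?_).trans hg1
    filter_upwards [hkg, ae_restrict_mem hΩ.measurableSet] with x hx hxΩ
    have hgx : 0 ≤ g x := ge_of_tendsto' hx fun n => abs_rpow_nonneg _ _
    rw [Set.indicator_of_mem hxΩ, abs_of_nonneg (by positivity), ← Real.rpow_mul hgx,
      one_div_mul_cancel hq.ne', Real.rpow_one]
  · filter_upwards [(ae_restrict_iff' hΩ.measurableSet).1 hkg,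
      ae_all_iff.2 fun n => ae_eq_zero_of_mem_D0 (hψ n).1] with x hx hx0
    by_cases hxΩ : x ∈ Ω
    · rw [Set.indicator_of_mem hxΩ]
      refine ((hx hxΩ).rpow_const (p := 1 / q) (Or.inr (by positivity))).congr fun n => ?_
      rw [abs_of_nonneg (hψ0 _ x), ← Real.rpow_mul (hψ0 _ x), mul_one_div_cancel hq.ne',
        Real.rpow_one]
    · simp only [Set.indicator_of_notMem hxΩ, hx0 _ hxΩ, tendsto_const_nhds]

omit hs hΩ hq hq2 hpos in
lemma exists_isTestFunction_tendsto_lambdaOne :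
    ∃ φ : ℕ → 𝔼 N → ℝ, (∀ n, IsTestFunction Ω (φ n)) ∧ (∀ n, ∫ x in Ω, |φ n x| ^ q = 1) ∧
      Antitone (fun n => energy s (φ n)) ∧
      Tendsto (fun n => energy s (φ n)) atTop (𝓝 (lambdaOne Ω s q)) := by
  have hne : {e | ∃ φ : 𝔼 N → ℝ,
      IsTestFunction Ω φ ∧ ∫ x in Ω, |φ x| ^ q = 1 ∧ e = energy s φ}.Nonempty := by
    contrapose! hfin
    rw [lambdaOne, hfin, sInf_empty]
  obtain ⟨e, hanti, he, hmem⟩ := exists_seq_tendsto_sInf hne (OrderBot.bddBelow _)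
  choose φ hφ hφ1 hφe using hmem
  obtain rfl : e = fun n => energy s (φ n) := funext hφe
  exact ⟨φ, hφ, hφ1, hanti, he⟩

lemma exists_isMinimiser : ∃ u, IsMinimiser Ω s q u := by
  obtain ⟨φ, hφ, hφ1, hanti, hφe⟩ := exists_isTestFunction_tendsto_lambdaOne hfin
  have habs (n : ℕ) : |φ n| ∈ constraintSet Ω s q :=
    ⟨abs_mem_D0 hs hΩ (hφ n).mem_D0, by simpa only [Pi.abs_apply, abs_abs] using hφ1 n⟩
  have hfe (n : ℕ) : HasFiniteEnergy s |φ n| := hasFiniteEnergy_of_mem_D0 hs (habs n).1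
  have habse : Tendsto (fun n => energy s |φ n|) atTop (𝓝 (lambdaOne Ω s q)) :=
    tendsto_of_tendsto_of_tendsto_of_le_of_le tendsto_const_nhds hφe
      (fun n => lambdaOne_le_energy hs hq hpos (habs n)) fun n => energy_abs_le s (φ n)
  obtain ⟨u, hu1, k, hk, hku⟩ := exists_subseq_tendsto_ae_of_minimising hs hΩ hq hq2 hpos hfin
    habs (fun n x => abs_nonneg _)
    (by simpa only [← (hfe _).toReal_energy, Function.comp_def] using
      (ENNReal.tendsto_toReal hfin).comp habse)
  have hke := habse.comp hk.tendsto_atTop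
  have hu : u ∈ D0 Ω s :=
    mem_D0_of_tendsto hs hΩ (f := fun n => |φ (k n)|) (fun n => (hφ _).continuous.abs)
      (fun n => (hφ _).2.1.comp_left abs_zero)
      (fun n => (tsupport_comp_subset abs_zero _).trans (hφ _).2.2)
      ((hφ 0).hasFiniteEnergy hs).energy_lt_top.ne
      (fun n => (energy_abs_le s _).trans (hanti (Nat.zero_le _))) hku
  refine ⟨u, ⟨hu, hu1⟩, le_antisymm ?_ (lambdaOne_le_energy hs hq hpos ⟨hu, hu1⟩)⟩
  exact (energy_le_liminf (fun n => (hφ _).continuous.abs.aemeasurable) hku).trans_eq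
    hke.liminf_eq

end Existence

lemma abs_rpow_sub_two_mul_self_mul_self (hq : 0 < q) (a : ℝ) :
    |a| ^ (q - 2) * a * a = |a| ^ q := by
  rcases eq_or_ne a 0 with rfl | ha
  · simp [hq.ne']
  · rw [mul_assoc, ← sq, ← sq_abs, ← Real.rpow_two, ← Real.rpow_add (abs_pos.2 ha),
      sub_add_cancel]

lemma abs_abs_rpow_sub_two_mul_self (hq : 1 < q) (a : ℝ) :
    |(|a| ^ (q - 2) * a)| = |a| ^ (q - 1) := by
  rcases eq_or_ne a 0 with rfl | ha
  · simp [(sub_pos.2 hq).ne']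
  · rw [abs_mul, abs_of_nonneg (abs_rpow_nonneg _ _), ← Real.rpow_add_one (abs_pos.2 ha).ne',
      show q - 2 + 1 = q - 1 by ring]

lemma abs_abs_rpow_sub_two_mul_mul_le (hq : 1 < q) (a b : ℝ) :
    |(|a| ^ (q - 2) * a * b)| ≤ (|a| + |b|) ^ q :=
  calc |(|a| ^ (q - 2) * a * b)| = |a| ^ (q - 1) * |b| := by
        rw [abs_mul, abs_abs_rpow_sub_two_mul_self hq]
    _ ≤ (|a| + |b|) ^ (q - 1) * (|a| + |b|) := by
        gcongr
        · exact le_add_of_nonneg_right (abs_nonneg b)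
        · exact le_add_of_nonneg_left (abs_nonneg a)
    _ = (|a| + |b|) ^ q := by
        rw [← Real.rpow_add_one' (by positivity) (by linarith), sub_add_cancel]

section Integral

variable {α : Type*} [MeasurableSpace α] {μ : Measure α} {f g : α → ℝ}
  (hq : 1 < q) (hf : AEMeasurable f μ) (hg : AEMeasurable g μ)
  (hfi : Integrable (fun x => |f x| ^ q) μ) (hgi : Integrable (fun x => |g x| ^ q) μ)

include hq hf hg hfi hgi

lemma integrable_abs_add_abs_rpow : Integrable (fun x => (|f x| + |g x|) ^ q) μ := by
  refine Integrable.mono' ((hfi.add hgi).const_mul (2 ^ (q - 1)))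
    ((hf.abs.add hg.abs).pow_const q).aestronglyMeasurable (Eventually.of_forall fun x => ?_)
  rw [Real.norm_eq_abs, abs_of_nonneg (by positivity)]
  exact_mod_cast NNReal.rpow_add_le_mul_rpow_add_rpow ⟨|f x|, abs_nonneg _⟩
    ⟨|g x|, abs_nonneg _⟩ hq.le

lemma integrable_abs_rpow_sub_two_mul_mul :
    Integrable (fun x => |f x| ^ (q - 2) * f x * g x) μ :=
  (integrable_abs_add_abs_rpow hq hf hg hfi hgi).mono'
    (((hf.abs.pow_const _).mul hf).mul hg).aestronglyMeasurable
    (Eventually.of_forall fun _ => abs_abs_rpow_sub_two_mul_mul_le hq _ _)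

lemma hasDerivAt_integral_abs_add_mul_rpow :
    HasDerivAt (fun t : ℝ => ∫ x, |f x + t * g x| ^ q ∂μ)
      (q * ∫ x, |f x| ^ (q - 2) * f x * g x ∂μ) 0 := by
  have hbound (x : α) (t : ℝ) (ht : t ∈ Metric.ball (0 : ℝ) 1) :
      ‖q * (|f x + t * g x| ^ (q - 2) * (f x + t * g x) * g x)‖ ≤
        q * (|f x| + |2 * g x|) ^ q := by
    rw [Real.norm_eq_abs, abs_mul, abs_of_pos (one_pos.trans hq)]
    gcongr
    refine (abs_abs_rpow_sub_two_mul_mul_le hq _ _).trans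
      (Real.rpow_le_rpow (by positivity) ?_ (by linarith))
    have ht1 : |t| ≤ 1 := (mem_ball_zero_iff.1 ht).le
    calc |f x + t * g x| + |g x| ≤ |f x| + |t| * |g x| + |g x| := by
          rw [← abs_mul]
          gcongr
          exact abs_add_le _ _
      _ ≤ |f x| + 1 * |g x| + |g x| := by gcongr
      _ = |f x| + |2 * g x| := by rw [abs_mul, abs_two]; ring
  have hderiv (x : α) (t : ℝ) : HasDerivAt (fun t : ℝ => |f x + t * g x| ^ q)
      (q * (|f x + t * g x| ^ (q - 2) * (f x + t * g x) * g x)) t := by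
    refine ((hasDerivAt_abs_rpow _ hq).comp t
      (((hasDerivAt_id t).mul_const (g x)).const_add (f x))).congr_deriv ?_
    simp only [id]
    ring
  have hmain := (hasDerivAt_integral_of_dominated_loc_of_deriv_le (μ := μ)
    (F := fun (t : ℝ) x => |f x + t * g x| ^ q) (x₀ := 0) (Metric.ball_mem_nhds 0 one_pos)
    (Eventually.of_forall fun t => ((hf.add (hg.const_mul t)).abs.pow_const q).aestronglyMeasurable)
    (by simpa only [zero_mul, add_zero] using hfi)
    (by simpa only [zero_mul, add_zero, Pi.mul_apply] using
      ((((hf.abs.pow_const (q - 2)).mul hf).mul hg).const_mul q).aestronglyMeasurable)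
    (Eventually.of_forall hbound)
    ((integrable_abs_add_abs_rpow hq hf (hg.const_mul 2) hfi (by
      simpa only [abs_mul, Real.mul_rpow (abs_nonneg _) (abs_nonneg _)] using
        hgi.const_mul (|2| ^ q))).const_mul q)
    (Eventually.of_forall fun x t _ => hderiv x t)).2
  simpa only [zero_mul, add_zero, integral_const_mul] using hmain

end Integral

lemma HasFiniteEnergy.hasDerivAt_energyForm_add_smul (hu : HasFiniteEnergy s u)
    (hv : HasFiniteEnergy s v) :
    HasDerivAt (fun t : ℝ => energyForm s (u + t • v) (u + t • v)) (2 * energyForm s u v) 0 := by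
  have hexp : (fun t : ℝ => energyForm s (u + t • v) (u + t • v)) =
      fun t => energyForm s u u + 2 * (t * energyForm s u v) + t ^ 2 * energyForm s v v := by
    funext t
    rw [hu.energyForm_add_self (hv.smul t), energyForm_smul_left, energyForm_smul_right,
      energyForm_smul_right]
    ring
  rw [hexp]
  have hlin := (((hasDerivAt_id (0 : ℝ)).mul_const (energyForm s u v)).const_mul 2).const_add
    (energyForm s u u)
  have hquad := ((hasDerivAt_id (0 : ℝ)).pow 2).mul_const (energyForm s v v)
  exact (hlin.add hquad).congr_deriv (by simp)

section EulerLagrange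

variable (hs : s ∈ Set.Ioo (0 : ℝ) 1) (hΩ : IsOpen Ω) (hq : 1 < q)
  (hpos : 0 < lambdaOne Ω s q)

include hs

lemma IsMinimiser.toReal_lambdaOne_eq (hu : IsMinimiser Ω s q u) :
    (lambdaOne Ω s q).toReal = energyForm s u u := by
  rw [← hu.2, (hasFiniteEnergy_of_mem_D0 hs hu.1.1).toReal_energy]

include hpos

lemma IsMinimiser.toReal_lambdaOne_pos (hu : IsMinimiser Ω s q u) :
    0 < (lambdaOne Ω s q).toReal := by
  refine ENNReal.toReal_pos hpos.ne' ?_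
  rw [← hu.2]
  exact (hasFiniteEnergy_of_mem_D0 hs hu.1.1).energy_lt_top.ne

include hΩ hq

lemma IsMinimiser.energyForm_eq (hu : IsMinimiser Ω s q u) (hv : v ∈ D0 Ω s) :
    energyForm s u v = (lambdaOne Ω s q).toReal * ∫ x in Ω, |u x| ^ (q - 2) * u x * v x := by
  have hq0 : 0 < q := one_pos.trans hq
  have h1 : ∫ x in Ω, |u x + 0 * v x| ^ q = 1 := by simpa only [zero_mul, add_zero] using hu.1.2
  have hconstraint := (hasDerivAt_integral_abs_add_mul_rpow hq
    (aemeasurable_of_mem_D0 hu.1.1).restrict (aemeasurable_of_mem_D0 hv).restrict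
    (integrableOn_abs_rpow hs hq0 hpos hu.1.1)
    (integrableOn_abs_rpow hs hq0 hpos hv)).rpow_const (p := 2 / q)
      (Or.inl (h1.trans_ne one_ne_zero))
  have henergy := (hasFiniteEnergy_of_mem_D0 hs hu.1.1).hasDerivAt_energyForm_add_smul
    (hasFiniteEnergy_of_mem_D0 hs hv)
  have hmin : IsLocalMin (fun t : ℝ => energyForm s (u + t • v) (u + t • v) -
      (lambdaOne Ω s q).toReal * (∫ x in Ω, |u x + t * v x| ^ q) ^ (2 / q)) 0 := by
    refine Eventually.of_forall fun t => ?_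
    simp only [h1, Real.one_rpow, zero_smul, add_zero, mul_one, hu.toReal_lambdaOne_eq hs,
      sub_self]
    rw [← hu.toReal_lambdaOne_eq hs]
    exact sub_nonneg.2 (toReal_lambdaOne_mul_le_energyForm hs hq0 hpos
      (add_mem_D0 hs hΩ hu.1.1 (smul_mem_D0 hs hΩ hv t)))
  have hzero := hmin.hasDerivAt_eq_zero (henergy.sub (hconstraint.const_mul _))
  rw [h1, Real.one_rpow] at hzero
  field_simp at hzero
  linarith

lemma IsMinimiser.isEigenfunction (hu : IsMinimiser Ω s q u) :
    IsEigenfunction Ω s q (lambdaOne Ω s q).toReal u where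
  pos := hu.toReal_lambdaOne_pos hs hpos
  mem := hu.1.1
  integrableOn := integrableOn_abs_rpow hs (one_pos.trans hq) hpos hu.1.1
  nontrivial h := by
    refine one_ne_zero (hu.1.2.symm.trans (integral_eq_zero_of_ae (ae_restrict_of_ae ?_)))
    filter_upwards [h] with x hx
    simp only [hx, Pi.zero_apply, abs_zero, Real.zero_rpow (one_pos.trans hq).ne']
  weak φ hφ := by
    rw [hu.energyForm_eq hs hΩ hq hpos hφ, hu.1.2, Real.one_rpow, Real.one_rpow, mul_one]

end EulerLagrange

namespace IsEigenfunction

variable {lam : ℝ} (hu : IsEigenfunction Ω s q lam u)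

include hu

lemma congr (h : u =ᵐ[volume] v) : IsEigenfunction Ω s q lam v where
  pos := hu.pos
  mem := D0_congr hu.mem h
  integrableOn := hu.integrableOn.congr <| ae_restrict_of_ae <| by
    filter_upwards [h] with x hx
    rw [hx]
  nontrivial hv := hu.nontrivial (h.trans hv)
  weak φ hφ := by
    have hpow : ∫ x in Ω, |u x| ^ q = ∫ x in Ω, |v x| ^ q :=
      integral_congr_ae (ae_restrict_of_ae (h.fun_comp fun t => |t| ^ q))
    have hweak : ∫ x in Ω, |u x| ^ (q - 2) * u x * φ x = ∫ x in Ω, |v x| ^ (q - 2) * v x * φ x :=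
      integral_congr_ae (ae_restrict_of_ae
        ((h.fun_comp fun t => |t| ^ (q - 2) * t).mul EventuallyEq.rfl))
    rw [← energyForm_congr h EventuallyEq.rfl, hu.weak φ hφ, hpow, hweak]

lemma smul (hs : s ∈ Set.Ioo (0 : ℝ) 1) (hΩ : IsOpen Ω) (hq : q ≠ 0) {c : ℝ} (hc : c ≠ 0) :
    IsEigenfunction Ω s q lam (c • u) where
  pos := hu.pos
  mem := smul_mem_D0 hs hΩ hu.mem c
  integrableOn := by
    simpa only [IntegrableOn, Pi.smul_apply, smul_eq_mul, abs_mul,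
      Real.mul_rpow (abs_nonneg _) (abs_nonneg _)] using hu.integrableOn.const_mul (|c| ^ q)
  nontrivial h := hu.nontrivial <| by
    filter_upwards [h] with x hx
    exact (mul_eq_zero.1 hx).resolve_left hc
  weak φ hφ := by
    have hpow : |c| ^ (2 - q) * |c| ^ (q - 2) = 1 := by
      rw [← Real.rpow_add (abs_pos.2 hc), sub_add_sub_cancel, sub_self, Real.rpow_zero]
    have hnorm : (∫ x in Ω, |(c • u) x| ^ q) ^ (1 / q) =
        |c| * (∫ x in Ω, |u x| ^ q) ^ (1 / q) := by
      rw [integral_abs_smul_rpow, Real.mul_rpow (abs_rpow_nonneg _ _)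
        (integral_abs_rpow_nonneg Ω q u), ← Real.rpow_mul (abs_nonneg c),
        mul_one_div_cancel hq, Real.rpow_one]
    have hintegrand (x : 𝔼 N) : |(c • u) x| ^ (q - 2) * (c • u) x * φ x =
        |c| ^ (q - 2) * c * (|u x| ^ (q - 2) * u x * φ x) := by
      rw [Pi.smul_apply, smul_eq_mul, abs_mul, Real.mul_rpow (abs_nonneg _) (abs_nonneg _)]
      ring
    rw [energyForm_smul_left, hu.weak φ hφ, hnorm, Real.mul_rpow (abs_nonneg c)
      (Real.rpow_nonneg (integral_abs_rpow_nonneg Ω q u) _)]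
    simp only [hintegrand, integral_const_mul]
    linear_combination (-(c * (lam * ((∫ x in Ω, |u x| ^ q) ^ (1 / q)) ^ (2 - q) *
      ∫ x in Ω, |u x| ^ (q - 2) * u x * φ x))) * hpow

lemma integral_pos (hΩ : IsOpen Ω) (hq : q ≠ 0) : 0 < ∫ x in Ω, |u x| ^ q := by
  refine (integral_abs_rpow_nonneg Ω q u).lt_of_ne fun h => hu.nontrivial ?_
  have hzero := (integral_eq_zero_iff_of_nonneg (fun _ => abs_rpow_nonneg _ _)
    hu.integrableOn).1 h.symm
  filter_upwards [(ae_restrict_iff' hΩ.measurableSet).1 hzero, ae_eq_zero_of_mem_D0 hu.mem]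
    with x hx hx'
  by_cases hxΩ : x ∈ Ω
  · exact abs_eq_zero.1 ((Real.rpow_eq_zero (abs_nonneg _) hq).1 (hx hxΩ))
  · exact hx' hxΩ

lemma exists_normalised (hs : s ∈ Set.Ioo (0 : ℝ) 1) (hΩ : IsOpen Ω) (hq : 0 < q) :
    ∃ c : ℝ, 0 < c ∧ ∫ x in Ω, |(c • u) x| ^ q = 1 ∧ IsEigenfunction Ω s q lam (c • u) := by
  have hm := hu.integral_pos hΩ hq.ne'
  have hc := Real.rpow_pos_of_pos hm (-1 / q)
  exact ⟨_, hc, integral_abs_normalised_rpow hq hm, hu.smul hs hΩ hq.ne' hc.ne'⟩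

lemma energyForm_eq (h1 : ∫ x in Ω, |u x| ^ q = 1) (hv : v ∈ D0 Ω s) :
    energyForm s u v = lam * ∫ x in Ω, |u x| ^ (q - 2) * u x * v x := by
  rw [hu.weak v hv, h1, Real.one_rpow, Real.one_rpow, mul_one]

lemma energyForm_self (hq : 0 < q) (h1 : ∫ x in Ω, |u x| ^ q = 1) : energyForm s u u = lam := by
  simp only [hu.energyForm_eq h1 hu.mem, abs_rpow_sub_two_mul_self_mul_self hq, h1, mul_one]

lemma lambdaOne_le (hs : s ∈ Set.Ioo (0 : ℝ) 1) (hΩ : IsOpen Ω) (hq : 0 < q)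
    (hpos : 0 < lambdaOne Ω s q) : (lambdaOne Ω s q).toReal ≤ lam := by
  obtain ⟨c, -, h1, hcu⟩ := hu.exists_normalised hs hΩ hq
  have h := toReal_lambdaOne_mul_le_energyForm hs hq hpos hcu.mem
  rwa [h1, Real.one_rpow, mul_one, hcu.energyForm_self hq h1] at h

end IsEigenfunction

lemma isEigenfunction_lambdaOne_iff (hs : s ∈ Set.Ioo (0 : ℝ) 1) (hΩ : IsOpen Ω) (hq : 1 < q)
    (hpos : 0 < lambdaOne Ω s q) :
    IsEigenfunction Ω s q (lambdaOne Ω s q).toReal u ↔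
      ∃ c : ℝ, c ≠ 0 ∧ IsMinimiser Ω s q (c • u) := by
  have hq0 : 0 < q := one_pos.trans hq
  constructor
  · intro hu
    obtain ⟨c, hc, h1, hcu⟩ := hu.exists_normalised hs hΩ hq0
    refine ⟨c, hc.ne', ⟨hcu.mem, h1⟩, ?_⟩
    rw [(hasFiniteEnergy_of_mem_D0 hs hcu.mem).energy_eq_ofReal, hcu.energyForm_self hq0 h1,
      ENNReal.ofReal_toReal (ENNReal.toReal_pos_iff.1 hu.pos).2.ne]
  · rintro ⟨c, hc, hcu⟩
    have := (hcu.isEigenfunction hs hΩ hq hpos).smul hs hΩ hq0.ne' (inv_ne_zero hc)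
    rwa [inv_smul_smul₀ hc] at this

lemma ae_restrict_of_forall_isTestFunction (hΩ : IsOpen Ω) {P : 𝔼 N → Prop}
    (h : ∀ φ, IsTestFunction Ω φ → ∀ᵐ x, φ x ≠ 0 → P x) : ∀ᵐ x ∂volume.restrict Ω, P x := by
  rw [ae_restrict_iff' hΩ.measurableSet, ae_iff]
  refine measure_null_of_locally_null _ fun x hx => ?_
  obtain ⟨φ, hφ, hφx⟩ := exists_isTestFunction_eventually_ne_zero hΩ (Classical.not_imp.1 hx).1
  refine ⟨_, inter_mem_nhdsWithin _ hφx, measure_mono_null ?_ (ae_iff.1 (h φ hφ))⟩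
  exact fun y hy => Classical.not_imp.2 ⟨hy.2, (Classical.not_imp.1 hy.1).2⟩

lemma abs_sq_div_sub_sq_div_le {A B C D M ε : ℝ} (hA : A ∈ Set.Icc 0 M) (hC : C ∈ Set.Icc 0 M)
    (hε : 0 < ε) (hB : ε ≤ B) (hD : ε ≤ D) :
    |A ^ 2 / B - C ^ 2 / D| ≤ 2 * M / ε * |A - C| + M ^ 2 / ε ^ 2 * |B - D| := by
  have hB0 : 0 < B := hε.trans_le hB
  have hD0 : 0 < D := hε.trans_le hD
  have hAC : 0 ≤ A + C := add_nonneg hA.1 hC.1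
  have hM : 0 ≤ M := hA.1.trans hA.2
  have hsum : A + C ≤ 2 * M := by linarith [hA.2, hC.2]
  calc |A ^ 2 / B - C ^ 2 / D|
      = |(A + C) / D * (A - C) + A ^ 2 / (B * D) * (D - B)| := by
        congr 1
        field_simp
        ring
    _ ≤ (A + C) / D * |A - C| + A ^ 2 / (B * D) * |D - B| := by
        refine (abs_add_le _ _).trans_eq ?_
        rw [abs_mul, abs_mul, abs_of_nonneg (by positivity : 0 ≤ (A + C) / D),
          abs_of_nonneg (by positivity : 0 ≤ A ^ 2 / (B * D))]
    _ ≤ 2 * M / ε * |A - C| + M ^ 2 / ε ^ 2 * |B - D| := by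
        rw [abs_sub_comm D B, sq ε]
        gcongr
        exacts [hA.1, hA.2]

lemma exists_lipschitzWith_min_sq_div_add {M ε : ℝ} (hM : 0 ≤ M) (hε : 0 < ε) :
    ∃ K, LipschitzWith K fun p : ℝ × ℝ => min |p.1| M ^ 2 / (|p.2| + ε) := by
  refine ⟨(2 * M / ε + M ^ 2 / ε ^ 2).toNNReal, LipschitzWith.of_dist_le' fun p r => ?_⟩
  have hfst : |min |p.1| M - min |r.1| M| ≤ dist p r := by
    refine (abs_min_sub_min_le_max |p.1| M |r.1| M).trans ?_
    rw [sub_self, abs_zero, max_eq_left (abs_nonneg _)]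
    exact (abs_abs_sub_abs_le p.1 r.1).trans (le_max_left _ _)
  have hsnd : |(|p.2| + ε) - (|r.2| + ε)| ≤ dist p r := by
    rw [add_sub_add_right_eq_sub]
    exact (abs_abs_sub_abs_le p.2 r.2).trans (le_max_right _ _)
  rw [Real.dist_eq, add_mul]
  refine (abs_sq_div_sub_sq_div_le ⟨le_min (abs_nonneg _) hM, min_le_right _ _⟩
    ⟨le_min (abs_nonneg _) hM, min_le_right _ _⟩ hε (le_add_of_nonneg_left (abs_nonneg _))
    (le_add_of_nonneg_left (abs_nonneg _))).trans ?_
  gcongr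

lemma picone_identity {a b : ℝ} (ha : 0 < a) (hb : 0 < b) (c d : ℝ) :
    (c - d) ^ 2 - (a - b) * (c ^ 2 / a - d ^ 2 / b) = (a * d - b * c) ^ 2 / (a * b) := by
  field_simp
  ring

/-- The pointwise gap in the discrete Picone inequality for `φ` against the test function
`φ² / (u + ε)`, where `u ≥ 0`; the shift `ε > 0` keeps the denominator away from the zeros of
`u`. -/
noncomputable def piconeGap (s ε : ℝ) (u φ : 𝔼 N → ℝ) (p : 𝔼 N × 𝔼 N) : ℝ :=
  diffQuot s φ p ^ 2 - diffQuot s u p * diffQuot s (fun x => φ x ^ 2 / (u x + ε)) p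

section Picone

variable {φ : 𝔼 N → ℝ} {ε : ℝ} (hu0 : 0 ≤ u) (hε : 0 < ε)

include hu0 hε

lemma piconeGap_eq (s : ℝ) (φ : 𝔼 N → ℝ) (p : 𝔼 N × 𝔼 N) :
    piconeGap s ε u φ p =
      ((u p.1 + ε) * φ p.2 - (u p.2 + ε) * φ p.1) ^ 2 / ((u p.1 + ε) * (u p.2 + ε)) /
        ‖p.1 - p.2‖ ^ ((N : ℝ) + 2 * s) := by
  rw [piconeGap, diffQuot_sq, diffQuot_mul_diffQuot, ← sub_div,
    ← picone_identity (add_pos_of_nonneg_of_pos (hu0 p.1) hε)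
      (add_pos_of_nonneg_of_pos (hu0 p.2) hε), add_sub_add_right_eq_sub]

lemma piconeGap_nonneg (s : ℝ) (φ : 𝔼 N → ℝ) (p : 𝔼 N × 𝔼 N) : 0 ≤ piconeGap s ε u φ p := by
  have h₁ := add_pos_of_nonneg_of_pos (hu0 p.1) hε
  have h₂ := add_pos_of_nonneg_of_pos (hu0 p.2) hε
  rw [piconeGap_eq hu0 hε]
  positivity

variable (hs : s ∈ Set.Ioo (0 : ℝ) 1) (hΩ : IsOpen Ω) (hu : u ∈ D0 Ω s)
  (hφ : IsTestFunction Ω φ)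

include hs hΩ hu hφ

lemma sq_div_add_mem_D0 : (fun x => φ x ^ 2 / (u x + ε)) ∈ D0 Ω s := by
  obtain ⟨M, hM⟩ := hφ.2.1.exists_bound_of_continuous hφ.continuous
  have hM0 : 0 ≤ M := (norm_nonneg _).trans (hM 0)
  obtain ⟨K, hK⟩ := exists_lipschitzWith_min_sq_div_add hM0 hε
  refine D0_congr (comp_prodMk_mem_D0 hs hΩ hφ.mem_D0 hu hK (by simp [hM0]))
    (Eventually.of_forall fun x => ?_)
  have hφM : |φ x| ≤ M := hM x
  simp only [min_eq_left hφM, sq_abs, abs_of_nonneg (hu0 x)]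

lemma integrable_piconeGap : Integrable (piconeGap s ε u φ) :=
  (MemLp.integrable_sq (hφ.hasFiniteEnergy hs)).sub
    ((hasFiniteEnergy_of_mem_D0 hs hu).integrable_mul
      (hasFiniteEnergy_of_mem_D0 hs (sq_div_add_mem_D0 hu0 hε hs hΩ hu hφ)))

lemma integral_piconeGap :
    ∫ p, piconeGap s ε u φ p =
      energyForm s φ φ - energyForm s u fun x => φ x ^ 2 / (u x + ε) := by
  simp only [energyForm_eq_integral, ← sq]
  exact integral_sub (MemLp.integrable_sq (hφ.hasFiniteEnergy hs))
    ((hasFiniteEnergy_of_mem_D0 hs hu).integrable_mul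
      (hasFiniteEnergy_of_mem_D0 hs (sq_div_add_mem_D0 hu0 hε hs hΩ hu hφ)))

lemma energyForm_sq_div_add_le :
    (energyForm s u fun x => φ x ^ 2 / (u x + ε)) ≤ energyForm s φ φ := by
  rw [← sub_nonneg, ← integral_piconeGap hu0 hε hs hΩ hu hφ]
  exact integral_nonneg (piconeGap_nonneg hu0 hε s φ)

end Picone

lemma tendsto_piconeGap_atTop {φ : 𝔼 N → ℝ} (s : ℝ) (hu0 : 0 ≤ u) {p : 𝔼 N × 𝔼 N}
    (h₁ : 0 < u p.1) (h₂ : u p.2 = 0) (hφ : φ p.2 ≠ 0) :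
    Tendsto (fun ε => piconeGap s ε u φ p) (𝓝[>] 0) atTop := by
  have hnorm : 0 < ‖p.1 - p.2‖ :=
    norm_pos_iff.2 (sub_ne_zero.2 fun he => h₁.ne' ((congrArg u he).trans h₂))
  refine tendsto_atTop_mono' _ (f₁ := fun ε =>
    (u p.1 * φ p.2 ^ 2 * ε⁻¹ - 2 * φ p.1 * φ p.2) / ‖p.1 - p.2‖ ^ ((N : ℝ) + 2 * s)) ?_ ?_
  · filter_upwards [self_mem_nhdsWithin] with ε hε
    have hε0 : 0 < ε := hε
    rw [piconeGap_eq hu0 hε0, h₂]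
    gcongr ?_ / _
    calc u p.1 * φ p.2 ^ 2 * ε⁻¹ - 2 * φ p.1 * φ p.2
        ≤ (u p.1 * φ p.2 ^ 2 * ε⁻¹ - 2 * φ p.1 * φ p.2) +
            (φ p.2 ^ 2 + ε * φ p.1 ^ 2 / (u p.1 + ε)) := le_add_of_nonneg_right (by positivity)
      _ = ((u p.1 + ε) * φ p.2 - (0 + ε) * φ p.1) ^ 2 / ((u p.1 + ε) * (0 + ε)) := by
          field_simp
          ring
  · exact (tendsto_atTop_add_const_right _ _
      (tendsto_inv_nhdsGT_zero.const_mul_atTop (by positivity))).atTop_div_const (by positivity)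

lemma ae_pos_of_energyForm_nonneg (hs : s ∈ Set.Ioo (0 : ℝ) 1) (hΩ : IsOpen Ω) (hu : u ∈ D0 Ω s)
    (hu0 : 0 ≤ u) (hne : ¬ u =ᵐ[volume] 0)
    (hsuper : ∀ ψ ∈ D0 Ω s, 0 ≤ ψ → 0 ≤ energyForm s u ψ) :
    ∀ᵐ x ∂volume.restrict Ω, 0 < u x := by
  refine ae_restrict_of_forall_isTestFunction hΩ fun φ hφ => ?_
  let ε (n : ℕ) : ℝ := 1 / ((n : ℝ) + 1)
  have hε (n : ℕ) : 0 < ε n := Nat.one_div_pos_of_nat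
  have hε0 : Tendsto ε atTop (𝓝[>] 0) :=
    tendsto_nhdsWithin_iff.2 ⟨tendsto_one_div_add_atTop_nhds_zero_nat, Eventually.of_forall hε⟩
  have hle (n : ℕ) : ∫⁻ p, ENNReal.ofReal (piconeGap s (ε n) u φ p) ≤ energy s φ := by
    rw [← ofReal_integral_eq_lintegral_ofReal (integrable_piconeGap hu0 (hε n) hs hΩ hu hφ)
      (Eventually.of_forall (piconeGap_nonneg hu0 (hε n) s φ)),
      integral_piconeGap hu0 (hε n) hs hΩ hu hφ, (hφ.hasFiniteEnergy hs).energy_eq_ofReal]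
    refine ENNReal.ofReal_le_ofReal (sub_le_self _ (hsuper _
      (sq_div_add_mem_D0 hu0 (hε n) hs hΩ hu hφ) fun x => ?_))
    exact div_nonneg (sq_nonneg _) (add_nonneg (hu0 x) (hε n).le)
  have hzero : ∀ᵐ p : 𝔼 N × 𝔼 N, ¬ (0 < u p.1 ∧ u p.2 = 0 ∧ φ p.2 ≠ 0) := by
    filter_upwards [ae_not_tendsto_top_of_lintegral_le (fun n =>
      (integrable_piconeGap hu0 (hε n) hs hΩ hu hφ).aemeasurable.ennreal_ofReal)
      (hφ.hasFiniteEnergy hs).energy_lt_top.ne hle] with p hp ⟨h₁, h₂, h₃⟩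
    exact hp (ENNReal.tendsto_ofReal_nhds_top.2
      ((tendsto_piconeGap_atTop s hu0 h₁ h₂ h₃).comp hε0))
  rcases ae_not_or_ae_not_of_ae_prod (P := fun x => 0 < u x)
    (R := fun x => u x = 0 ∧ φ x ≠ 0) hzero with h | h
  · exact absurd (h.mono fun x hx => le_antisymm (not_lt.1 hx) (hu0 x)) hne
  · filter_upwards [h] with x hx hφx
    exact (hu0 x).lt_of_ne' fun hux => hx ⟨hux, hφx⟩

lemma IsEigenfunction.ae_pos_of_nonneg {lam : ℝ} (hu : IsEigenfunction Ω s q lam u)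
    (hs : s ∈ Set.Ioo (0 : ℝ) 1) (hΩ : IsOpen Ω) (hu0 : 0 ≤ u) :
    ∀ᵐ x ∂volume.restrict Ω, 0 < u x := by
  refine ae_pos_of_energyForm_nonneg hs hΩ hu.mem hu0 hu.nontrivial fun ψ hψ hψ0 => ?_
  rw [hu.weak ψ hψ]
  refine mul_nonneg (mul_nonneg hu.pos.le ?_) (integral_nonneg fun x => ?_)
  · exact Real.rpow_nonneg (Real.rpow_nonneg (integral_abs_rpow_nonneg Ω q u) _) _
  · exact mul_nonneg (mul_nonneg (abs_rpow_nonneg _ _) (hu0 x)) (hψ0 x)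

lemma abs_rpow_le_young {a : ℝ} (ha : 0 < a) (b : ℝ) (hq : 0 ≤ q) (hq2 : q ≤ 2) :
    |b| ^ q ≤ q / 2 * (a ^ (q - 2) * b ^ 2) + (1 - q / 2) * a ^ q :=
  calc |b| ^ q = (a ^ (q - 2) * b ^ 2) ^ (q / 2) * (a ^ q) ^ (1 - q / 2) := by
        rw [Real.mul_rpow (by positivity) (by positivity), ← Real.rpow_mul ha.le,
          ← Real.rpow_mul ha.le, ← sq_abs, ← Real.rpow_two, ← Real.rpow_mul (abs_nonneg _),
          mul_div_cancel₀ _ (two_ne_zero), mul_right_comm, ← Real.rpow_add ha,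
          show (q - 2) * (q / 2) + q * (1 - q / 2) = 0 by ring, Real.rpow_zero, one_mul]
    _ ≤ q / 2 * (a ^ (q - 2) * b ^ 2) + (1 - q / 2) * a ^ q :=
        Real.geom_mean_le_arith_mean2_weighted (by positivity) (by linarith) (by positivity)
          (by positivity) (add_sub_cancel _ _)

lemma ae_eq_abs_of_ae_nonneg (hΩ : IsOpen Ω) (hu : u ∈ D0 Ω s)
    (h : ∀ᵐ x ∂volume.restrict Ω, 0 ≤ u x) : u =ᵐ[volume] |u| := by
  filter_upwards [(ae_restrict_iff' hΩ.measurableSet).1 h, ae_eq_zero_of_mem_D0 hu] with x hx hx0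
  by_cases hxΩ : x ∈ Ω
  · exact (abs_of_nonneg (hx hxΩ)).symm
  · rw [Pi.abs_apply, hx0 hxΩ, abs_zero]

namespace IsEigenfunction

variable {lam : ℝ} {φ : 𝔼 N → ℝ} (hu : IsEigenfunction Ω s q lam u)
  (h1 : ∫ x in Ω, |u x| ^ q = 1) (hu0 : 0 ≤ u) (hs : s ∈ Set.Ioo (0 : ℝ) 1) (hΩ : IsOpen Ω)
  (hq : 1 < q) (hpos : 0 < lambdaOne Ω s q) (hφ : IsTestFunction Ω φ)

include hu h1 hu0 hs hΩ hq hpos hφ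

lemma lintegral_sq_div_add_le {ε : ℝ} (hε : 0 < ε) :
    ∫⁻ x in Ω, ENNReal.ofReal (|u x| ^ (q - 2) * u x * (φ x ^ 2 / (u x + ε))) ≤
      ENNReal.ofReal (energyForm s φ φ / lam) := by
  have hψ := sq_div_add_mem_D0 hu0 hε hs hΩ hu.mem hφ
  rw [← ofReal_integral_eq_lintegral_ofReal (integrable_abs_rpow_sub_two_mul_mul hq
    (aemeasurable_of_mem_D0 hu.mem).restrict (aemeasurable_of_mem_D0 hψ).restrict hu.integrableOn
    (integrableOn_abs_rpow hs (one_pos.trans hq) hpos hψ)) (Eventually.of_forall fun x =>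
      mul_nonneg (mul_nonneg (abs_rpow_nonneg _ _) (hu0 x))
        (div_nonneg (sq_nonneg _) (add_nonneg (hu0 x) hε.le)))]
  refine ENNReal.ofReal_le_ofReal ?_
  rw [le_div_iff₀' hu.pos, ← hu.energyForm_eq h1 hψ]
  exact energyForm_sq_div_add_le hu0 hε hs hΩ hu.mem hφ

lemma lintegral_rpow_mul_sq_le :
    ∫⁻ x in Ω, ENNReal.ofReal (u x ^ (q - 2) * φ x ^ 2) ≤
      ENNReal.ofReal (energyForm s φ φ / lam) := by
  let ε (n : ℕ) : ℝ := 1 / ((n : ℝ) + 1)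
  have hε (n : ℕ) : 0 < ε n := Nat.one_div_pos_of_nat
  have hε0 : Tendsto ε atTop (𝓝 0) := tendsto_one_div_add_atTop_nhds_zero_nat
  have humeas : AEMeasurable u (volume.restrict Ω) := (aemeasurable_of_mem_D0 hu.mem).restrict
  have hφmeas : Measurable φ := hφ.continuous.measurable
  calc ∫⁻ x in Ω, ENNReal.ofReal (u x ^ (q - 2) * φ x ^ 2)
      = ∫⁻ x in Ω, liminf (fun n => ENNReal.ofReal
          (|u x| ^ (q - 2) * u x * (φ x ^ 2 / (u x + ε n)))) atTop := by
        refine lintegral_congr_ae ?_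
        filter_upwards [hu.ae_pos_of_nonneg hs hΩ hu0] with x hx
        have hlim : Tendsto (fun n => |u x| ^ (q - 2) * u x * (φ x ^ 2 / (u x + ε n))) atTop
            (𝓝 (|u x| ^ (q - 2) * u x * (φ x ^ 2 / (u x + 0)))) :=
          (tendsto_const_nhds.div (hε0.const_add _) (by simpa using hx.ne')).const_mul _
        rw [abs_of_pos hx, add_zero, mul_assoc, mul_div_cancel₀ _ hx.ne'] at hlim
        simpa only [abs_of_pos hx] using (ENNReal.tendsto_ofReal hlim).liminf_eq.symm
    _ ≤ liminf (fun n => ∫⁻ x in Ω, ENNReal.ofReal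
          (|u x| ^ (q - 2) * u x * (φ x ^ 2 / (u x + ε n)))) atTop :=
        lintegral_liminf_le' fun n => by fun_prop
    _ ≤ ENNReal.ofReal (energyForm s φ φ / lam) :=
        liminf_le_of_frequently_le' (Eventually.of_forall fun n =>
          hu.lintegral_sq_div_add_le h1 hu0 hs hΩ hq hpos hφ (hε n)).frequently

lemma integrableOn_rpow_mul_sq : IntegrableOn (fun x => u x ^ (q - 2) * φ x ^ 2) Ω := by
  refine ⟨(((aemeasurable_of_mem_D0 hu.mem).pow_const _).mul
    (hφ.continuous.aemeasurable.pow_const 2)).restrict.aestronglyMeasurable, ?_⟩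
  rw [hasFiniteIntegral_iff_ofReal (Eventually.of_forall fun x =>
    mul_nonneg (Real.rpow_nonneg (hu0 x) _) (sq_nonneg _))]
  exact (hu.lintegral_rpow_mul_sq_le h1 hu0 hs hΩ hq hpos hφ).trans_lt ENNReal.ofReal_lt_top

lemma integral_rpow_mul_sq_mul_le :
    (∫ x in Ω, u x ^ (q - 2) * φ x ^ 2) * lam ≤ energyForm s φ φ := by
  rw [← le_div_iff₀ hu.pos,
    ← ENNReal.ofReal_le_ofReal_iff (div_nonneg (energyForm_self_nonneg s φ) hu.pos.le),
    ofReal_integral_eq_lintegral_ofReal (hu.integrableOn_rpow_mul_sq h1 hu0 hs hΩ hq hpos hφ)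
      (Eventually.of_forall fun x => mul_nonneg (Real.rpow_nonneg (hu0 x) _) (sq_nonneg _))]
  exact hu.lintegral_rpow_mul_sq_le h1 hu0 hs hΩ hq hpos hφ

lemma le_energyForm_of_nonneg (hq2 : q ≤ 2) (hφ1 : ∫ x in Ω, |φ x| ^ q = 1) :
    lam ≤ energyForm s φ φ := by
  have hq0 : 0 < q := one_pos.trans hq
  have hint := hu.integrableOn_rpow_mul_sq h1 hu0 hs hΩ hq hpos hφ
  have hyoung : ∫ x in Ω, |φ x| ^ q ≤ ∫ x in Ω,
      (q / 2 * (u x ^ (q - 2) * φ x ^ 2) + (1 - q / 2) * |u x| ^ q) := by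
    refine integral_mono_ae (hφ.integrable_abs_rpow hq0).integrableOn
      ((hint.const_mul _).add (hu.integrableOn.const_mul _)) ?_
    filter_upwards [hu.ae_pos_of_nonneg hs hΩ hu0] with x hx
    rw [abs_of_pos hx]
    exact abs_rpow_le_young hx _ hq0.le hq2
  rw [integral_add (hint.const_mul _) (hu.integrableOn.const_mul _), integral_const_mul,
    integral_const_mul, h1, hφ1] at hyoung
  have hone : 1 ≤ ∫ x in Ω, u x ^ (q - 2) * φ x ^ 2 := by
    refine le_of_mul_le_mul_left ?_ (half_pos hq0)
    linarith
  exact (le_mul_of_one_le_left hu.pos.le hone).trans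
    (hu.integral_rpow_mul_sq_mul_le h1 hu0 hs hΩ hq hpos hφ)

end IsEigenfunction

section FirstEigenvalue

variable (hs : s ∈ Set.Ioo (0 : ℝ) 1) (hΩ : IsOpen Ω) (hpos : 0 < lambdaOne Ω s q)

include hs hΩ hpos

namespace IsEigenfunction

variable {lam : ℝ} (hu : IsEigenfunction Ω s q lam u) (hq : 1 < q) (hq2 : q ≤ 2)
  (hfin : lambdaOne Ω s q ≠ ⊤)

include hu hq hq2 hfin

lemma eq_lambdaOne_of_nonneg (hu0 : ∀ᵐ x ∂volume.restrict Ω, 0 ≤ u x) :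
    lam = (lambdaOne Ω s q).toReal := by
  have hq0 : 0 < q := one_pos.trans hq
  refine le_antisymm ?_ (hu.lambdaOne_le hs hΩ hq0 hpos)
  obtain ⟨c, hc, h1, hcu⟩ :=
    (hu.congr (ae_eq_abs_of_ae_nonneg hΩ hu.mem hu0)).exists_normalised hs hΩ hq0
  refine (ENNReal.ofReal_le_iff_le_toReal hfin).1 (le_sInf ?_)
  rintro _ ⟨φ, hφ, hφ1, rfl⟩
  rw [(hφ.hasFiniteEnergy hs).energy_eq_ofReal]
  exact ENNReal.ofReal_le_ofReal (hcu.le_energyForm_of_nonneg h1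
    (smul_nonneg hc.le (abs_nonneg u)) hs hΩ hq hpos hφ hq2 hφ1)

lemma eq_lambdaOne_of_nonneg_or_nonpos
    (h : (∀ᵐ x ∂volume.restrict Ω, 0 ≤ u x) ∨ ∀ᵐ x ∂volume.restrict Ω, u x ≤ 0) :
    lam = (lambdaOne Ω s q).toReal := by
  rcases h with h | h
  · exact hu.eq_lambdaOne_of_nonneg hs hΩ hpos hq hq2 hfin h
  · refine (hu.smul hs hΩ (one_pos.trans hq).ne' (neg_ne_zero.2 one_ne_zero)).eq_lambdaOne_of_nonneg
      hs hΩ hpos hq hq2 hfin (h.mono fun x hx => ?_)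
    rwa [neg_one_smul, Pi.neg_apply, Left.nonneg_neg_iff]

end IsEigenfunction

lemma ae_eq_of_ae_le_of_integral_abs_rpow_eq (hq : 0 < q) (hu : u ∈ D0 Ω s) (hv : v ∈ D0 Ω s)
    (hu0 : 0 ≤ᵐ[volume] u) (hle : u ≤ᵐ[volume] v)
    (h : ∫ x in Ω, |u x| ^ q = ∫ x in Ω, |v x| ^ q) : u =ᵐ[volume] v := by
  have hle' : (fun x => |u x| ^ q) ≤ᵐ[volume.restrict Ω] fun x => |v x| ^ q := by
    filter_upwards [ae_restrict_of_ae hle, ae_restrict_of_ae hu0] with x hx hx0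
    exact Real.rpow_le_rpow (abs_nonneg _) (abs_le_abs_of_nonneg hx0 hx) hq.le
  have heq := (integral_eq_iff_of_ae_le (integrableOn_abs_rpow hs hq hpos hu)
    (integrableOn_abs_rpow hs hq hpos hv) hle').1 h
  filter_upwards [(ae_restrict_iff' hΩ.measurableSet).1 heq, ae_eq_zero_of_mem_D0 hu,
    ae_eq_zero_of_mem_D0 hv, hu0, hle] with x hx hxu hxv hx0 hxle
  by_cases hxΩ : x ∈ Ω
  · have habs := (Real.rpow_left_inj (abs_nonneg _) (abs_nonneg _) hq.ne').1 (hx hxΩ)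
    rwa [abs_of_nonneg hx0, abs_of_nonneg (hx0.trans hxle)] at habs
  · rw [hxu hxΩ, hxv hxΩ]

namespace IsMinimiser

omit hpos in
lemma neg (hu : IsMinimiser Ω s q u) : IsMinimiser Ω s q (-u) := by
  refine ⟨⟨?_, ?_⟩, ?_⟩
  · simpa only [neg_one_smul] using smul_mem_D0 hs hΩ hu.1.1 (-1)
  · simpa only [Pi.neg_apply, abs_neg] using hu.1.2
  · simpa using (energy_smul s (-1) u).trans (by simpa using hu.2)

lemma ae_le_or_ae_le (hq : 0 < q) (hq2 : q ≤ 2) (hu : IsMinimiser Ω s q u)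
    (hv : IsMinimiser Ω s q v) : (∀ᵐ x, u x ≤ v x) ∨ ∀ᵐ x, v x ≤ u x := by
  have hue := hasFiniteEnergy_of_mem_D0 hs hu.1.1
  have hve := hasFiniteEnergy_of_mem_D0 hs hv.1.1
  have hsum := integral_sup_rpow_add_integral_inf_rpow hs hΩ hq hpos hu.1.1 hv.1.1
  rw [hu.1.2, hv.1.2, one_add_one_eq_two] at hsum
  refine ae_le_or_ae_le_of_energy_le (aemeasurable_of_mem_D0 hu.1.1) (aemeasurable_of_mem_D0 hv.1.1)
    (ENNReal.add_ne_top.2 ⟨hue.energy_lt_top.ne, hve.energy_lt_top.ne⟩) ?_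
  rw [hue.energy_eq_ofReal, hve.energy_eq_ofReal,
    (hasFiniteEnergy_of_mem_D0 hs (sup_mem_D0 hs hΩ hu.1.1 hv.1.1)).energy_eq_ofReal,
    (hasFiniteEnergy_of_mem_D0 hs (inf_mem_D0 hs hΩ hu.1.1 hv.1.1)).energy_eq_ofReal,
    ← ENNReal.ofReal_add (energyForm_self_nonneg s _) (energyForm_self_nonneg s _),
    ← ENNReal.ofReal_add (energyForm_self_nonneg s _) (energyForm_self_nonneg s _)]
  refine ENNReal.ofReal_le_ofReal ?_
  calc energyForm s u u + energyForm s v v = (lambdaOne Ω s q).toReal * 2 := by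
        rw [← hu.toReal_lambdaOne_eq hs, ← hv.toReal_lambdaOne_eq hs, mul_two]
    _ ≤ (lambdaOne Ω s q).toReal *
          ((∫ x in Ω, |(u ⊔ v) x| ^ q) ^ (2 / q) + (∫ x in Ω, |(u ⊓ v) x| ^ q) ^ (2 / q)) :=
        mul_le_mul_of_nonneg_left (two_le_rpow_add_rpow ((one_le_div hq).2 hq2)
          (integral_abs_rpow_nonneg Ω q _) (integral_abs_rpow_nonneg Ω q _) hsum)
          ENNReal.toReal_nonneg
    _ ≤ _ := toReal_lambdaOne_mul_sup_add_inf_le hs hΩ hq hpos hu.1.1 hv.1.1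

lemma ae_nonneg_or_ae_nonpos (hq : 0 < q) (hq2 : q ≤ 2) (hu : IsMinimiser Ω s q u) :
    0 ≤ᵐ[volume] u ∨ u ≤ᵐ[volume] 0 :=
  (ae_le_or_ae_le hs hΩ hpos hq hq2 (hu.neg hs hΩ) hu).imp
    (Eventually.mono · fun _ => neg_le_self_iff.1) (Eventually.mono · fun _ => le_neg_self_iff.1)

lemma ae_eq_of_nonneg (hq : 0 < q) (hq2 : q ≤ 2) (hu : IsMinimiser Ω s q u)
    (hv : IsMinimiser Ω s q v) (hu0 : 0 ≤ᵐ[volume] u) (hv0 : 0 ≤ᵐ[volume] v) :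
    u =ᵐ[volume] v := by
  have h : ∫ x in Ω, |u x| ^ q = ∫ x in Ω, |v x| ^ q := hu.1.2.trans hv.1.2.symm
  rcases ae_le_or_ae_le hs hΩ hpos hq hq2 hu hv with hle | hle
  · exact ae_eq_of_ae_le_of_integral_abs_rpow_eq hs hΩ hpos hq hu.1.1 hv.1.1 hu0 hle h
  · exact (ae_eq_of_ae_le_of_integral_abs_rpow_eq hs hΩ hpos hq hv.1.1 hu.1.1 hv0 hle h.symm).symm

end IsMinimiser

namespace IsEigenfunction

variable (hq : 1 < q) (hq2 : q ≤ 2) (hu : IsEigenfunction Ω s q (lambdaOne Ω s q).toReal u)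

include hq hq2 hu

lemma exists_isMinimiser_smul_nonneg :
    ∃ c : ℝ, c ≠ 0 ∧ IsMinimiser Ω s q (c • u) ∧ 0 ≤ᵐ[volume] c • u := by
  obtain ⟨c, hc, hcu⟩ := (isEigenfunction_lambdaOne_iff hs hΩ hq hpos).1 hu
  rcases hcu.ae_nonneg_or_ae_nonpos hs hΩ hpos (one_pos.trans hq) hq2 with h | h
  · exact ⟨c, hc, hcu, h⟩
  · refine ⟨-c, neg_ne_zero.2 hc, ?_, h.mono fun x hx => ?_⟩
    · simpa only [neg_smul] using hcu.neg hs hΩ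
    · rw [neg_smul]
      exact neg_nonneg.2 hx

lemma exists_ae_eq_smul (hv : IsEigenfunction Ω s q (lambdaOne Ω s q).toReal v) :
    ∃ c : ℝ, c ≠ 0 ∧ v =ᵐ[volume] c • u := by
  obtain ⟨c, hc, hcu, hcu0⟩ := exists_isMinimiser_smul_nonneg hs hΩ hpos hq hq2 hu
  obtain ⟨d, hd, hdv, hdv0⟩ := exists_isMinimiser_smul_nonneg hs hΩ hpos hq hq2 hv
  refine ⟨d⁻¹ * c, mul_ne_zero (inv_ne_zero hd) hc, ?_⟩
  filter_upwards [hcu.ae_eq_of_nonneg hs hΩ hpos (one_pos.trans hq) hq2 hdv hcu0 hdv0] with x hx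
  rw [mul_smul, Pi.smul_apply, hx, Pi.smul_apply, inv_smul_smul₀ hd]

lemma ae_pos_or_ae_neg :
    (∀ᵐ x ∂volume.restrict Ω, 0 < u x) ∨ ∀ᵐ x ∂volume.restrict Ω, u x < 0 := by
  obtain ⟨c, hc, hcu, hcu0⟩ := exists_isMinimiser_smul_nonneg hs hΩ hpos hq hq2 hu
  have habs := ae_eq_abs_of_ae_nonneg hΩ hcu.1.1 (ae_restrict_of_ae hcu0)
  have hcpos : ∀ᵐ x ∂volume.restrict Ω, 0 < c * u x := by
    filter_upwards [((hcu.isEigenfunction hs hΩ hq hpos).congr habs).ae_pos_of_nonneg hs hΩ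
      (abs_nonneg _), ae_restrict_of_ae habs] with x hx hxabs
    exact hx.trans_eq hxabs.symm
  rcases hc.lt_or_gt with hc | hc
  · exact .inr (hcpos.mono fun x hx => neg_of_mul_pos_right hx hc.le)
  · exact .inl (hcpos.mono fun x hx => pos_of_mul_pos_right hx hc.le)

end IsEigenfunction

end FirstEigenvalue

end FracEig

theorem theoremA (N : ℕ) (hN : 1 ≤ N) (s : ℝ) (hs : s ∈ Set.Ioo (0 : ℝ) 1)
    (q : ℝ) (hq : q ∈ Set.Ioo (1 : ℝ) 2)
    (Ω : Set (EuclideanSpace ℝ (Fin N))) (hΩ : IsOpen Ω) (hne : Ω.Nonempty)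
    (hpos : 0 < FracEig.lambdaOne Ω s q) :
    -- the infimum is finite, and it is a minimum over the constraint set
    FracEig.lambdaOne Ω s q ≠ ⊤ ∧
    IsLeast (FracEig.energy s '' FracEig.constraintSet Ω s q) (FracEig.lambdaOne Ω s q) ∧
    -- it is the least eigenvalue
    IsLeast (FracEig.spectrum Ω s q) (FracEig.lambdaOne Ω s q).toReal ∧
    -- its eigenfunctions are the non-zero multiples of the minimisers
    (∀ u : EuclideanSpace ℝ (Fin N) → ℝ,
      FracEig.IsEigenfunction Ω s q (FracEig.lambdaOne Ω s q).toReal u ↔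
        ∃ c : ℝ, c ≠ 0 ∧ FracEig.IsMinimiser Ω s q (c • u)) ∧
    -- minimisers, and all first eigenfunctions, are unique up to a multiplicative constant
    (∀ u v : EuclideanSpace ℝ (Fin N) → ℝ,
      FracEig.IsMinimiser Ω s q u → FracEig.IsMinimiser Ω s q v →
        ∃ c : ℝ, c ≠ 0 ∧ v =ᵐ[volume] c • u) ∧
    (∀ u v : EuclideanSpace ℝ (Fin N) → ℝ,
      FracEig.IsEigenfunction Ω s q (FracEig.lambdaOne Ω s q).toReal u →
      FracEig.IsEigenfunction Ω s q (FracEig.lambdaOne Ω s q).toReal v →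
        ∃ c : ℝ, c ≠ 0 ∧ v =ᵐ[volume] c • u) ∧
    -- first eigenfunctions have constant (strict) sign
    (∀ u : EuclideanSpace ℝ (Fin N) → ℝ,
      FracEig.IsEigenfunction Ω s q (FracEig.lambdaOne Ω s q).toReal u →
        (∀ᵐ x ∂volume.restrict Ω, 0 < u x) ∨ (∀ᵐ x ∂volume.restrict Ω, u x < 0)) ∧
    -- no other eigenvalue has an eigenfunction of constant sign
    (∀ (lam : ℝ) (u : EuclideanSpace ℝ (Fin N) → ℝ),
      FracEig.IsEigenfunction Ω s q lam u →
      ((∀ᵐ x ∂volume.restrict Ω, 0 ≤ u x) ∨ (∀ᵐ x ∂volume.restrict Ω, u x ≤ 0)) →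
        lam = (FracEig.lambdaOne Ω s q).toReal) := by
  have hq0 : 0 < q := one_pos.trans hq.1
  have hfin := FracEig.lambdaOne_ne_top hs hΩ hne hq0
  obtain ⟨u₀, hu₀⟩ := FracEig.exists_isMinimiser hs hΩ hq0 hq.2 hpos hfin
  have heig (u) (hu : FracEig.IsMinimiser Ω s q u) := hu.isEigenfunction hs hΩ hq.1 hpos
  refine ⟨hfin, ⟨⟨u₀, hu₀.1, hu₀.2⟩, ?_⟩, ⟨⟨u₀, heig u₀ hu₀⟩, ?_⟩,
    fun u => FracEig.isEigenfunction_lambdaOne_iff hs hΩ hq.1 hpos,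
    fun u v hu hv => (heig u hu).exists_ae_eq_smul hs hΩ hpos hq.1 hq.2.le (heig v hv),
    fun u v hu hv => hu.exists_ae_eq_smul hs hΩ hpos hq.1 hq.2.le hv,
    fun u hu => hu.ae_pos_or_ae_neg hs hΩ hpos hq.1 hq.2.le,
    fun lam u hu h => hu.eq_lambdaOne_of_nonneg_or_nonpos hs hΩ hpos hq.1 hq.2.le hfin h⟩
  · rintro _ ⟨u, hu, rfl⟩
    exact FracEig.lambdaOne_le_energy hs hq0 hpos hu
  · rintro lam ⟨u, hu⟩
    exact hu.lambdaOne_le hs hΩ hq0 hpos
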